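/- Let $r\ge 3$ and $0\le s\le r$, and let $G^M$ be the graph with vertex set $U\cup V$, $U=\{u_1,\dots,u_r\}$, $V=\{v_1,\dots,v_s\}$, and edge set $E_u\cup E_{uv}$, where $E_u=\{e_i=(u_i,u_{i+1}):1\le i\le r\}$ (with $u_{r+1}=u_1$) and $E_{uv}=\{(u_i,v_j):1\le i\le r,\ 1\le j\le s\}$. An MEE-tour (matching edge ejection tour) is a Hamiltonian cycle of $G^M$ obtained by choosing distinct indices $\pi(1),\dots,\pi(s)\in\{1,\dots,r\}$, deleting the edges $e_{\pi(1)},\dots,e_{\pi(s)}$ from the cycle $E_u$, and joining each $v_j$ to both end points of $e_{\pi(j)}$; let $F(\mathrm{MEE})$ be the set of all MEE-tours, viewed as sets of edges. The problem QTSP(1,H)-MEE is, given $r$, $s$ and rational edge costs $a_e,b_e$ $(e\in E_u\cup E_{uv})$, to minimize $$q(\tau)=\Bigl(\sum_{e\in\tau}a_e\Bigr)\Bigl(\sum_{e\in\tau}b_e\Bigr)\quad\text{over }\tau\in F(\mathrm{MEE}).$$ **Corollary.** QTSP(1,H)-MEE with nonnegative costs $a,b\ge 0$ admits a fully polynomial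 time approximation scheme (FPTAS): there is an algorithm (a single program of a random access machine with logarithmic cost, which receives the instance together with the accuracy parameter $\lceil 1/\varepsilon\rceil$) that, for every such instance $I$ and every real $\varepsilon>0$, outputs a tour $\tau\in F(\mathrm{MEE})$ with $q(\tau)\le(1+\varepsilon)\,q(\tau')$ for all $\tau'\in F(\mathrm{MEE})$, in time bounded by a fixed polynomial in the binary encoding length of $I$ and $1/\varepsilon$. -/

import Mathlib

/-! ## A random access machine with logarithmic cost

A memory consists of banks `M 0, M 1, …`, each an array of natural numbers indexed by `ℕ`. A program
mentions finitely many banks, cells are addressed by computed values, and every operation is charged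
the binary lengths of all the numbers (addresses, operands, results) it handles. -/

namespace RAM

/-- Memory: `M x i` is the content of cell `i` of bank `x`. -/
abbrev Mem : Type := ℕ → ℕ → ℕ

/-- Arithmetic operations; `sub` is truncated at `0`, `div` rounds down (with `n / 0 = 0`). -/
inductive Op where
  | add | sub | mul | div

def Op.eval : Op → ℕ → ℕ → ℕ
  | .add, m, n => m + n
  | .sub, m, n => m - n
  | .mul, m, n => m * n
  | .div, m, n => m / n

/-- Expressions: constants, the cell of bank `x` at a computed address, arithmetic. -/
inductive Expr where
  | lit (n : ℕ)
  | get (x : ℕ) (i : Expr)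
  | bin (o : Op) (e₁ e₂ : Expr)

def Expr.eval (M : Mem) : Expr → ℕ
  | .lit n => n
  | .get x i => M x (i.eval M)
  | .bin o e₁ e₂ => o.eval (e₁.eval M) (e₂.eval M)

/-- Logarithmic cost of evaluating an expression; `Nat.size` is the binary length. -/
def Expr.cost (M : Mem) : Expr → ℕ
  | .lit n => Nat.size n + 1
  | .get x i => i.cost M + Nat.size (i.eval M) + Nat.size (M x (i.eval M)) + 1
  | .bin o e₁ e₂ => e₁.cost M + e₂.cost M + Nat.size (e₁.eval M) + Nat.size (e₂.eval M)
      + Nat.size (o.eval (e₁.eval M) (e₂.eval M)) + 1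

/-- Programs. Conditions hold when their value is nonzero. -/
inductive Cmd where
  | skip
  | set (x : ℕ) (i e : Expr)
  | seq (c₁ c₂ : Cmd)
  | ite (e : Expr) (c₁ c₂ : Cmd)
  | loop (e : Expr) (c : Cmd)

/-- The memory after writing `v` to cell `i` of bank `x`. -/
def Mem.write (M : Mem) (x i v : ℕ) : Mem :=
  fun y j => if y = x ∧ j = i then v else M y j

/-- `Exec c M t M'`: program `c`, started in memory `M`, halts in memory `M'` at total cost `t`. -/
inductive Exec : Cmd → Mem → ℕ → Mem → Prop where
  | skip (M : Mem) : Exec .skip M 1 M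
  | set (M : Mem) (x : ℕ) (i e : Expr) :
      Exec (.set x i e) M
        (i.cost M + e.cost M + Nat.size (i.eval M) + Nat.size (e.eval M) + 1)
        (M.write x (i.eval M) (e.eval M))
  | seq {c₁ c₂ : Cmd} {M M' M'' : Mem} {t₁ t₂ : ℕ}
      (h₁ : Exec c₁ M t₁ M') (h₂ : Exec c₂ M' t₂ M'') :
      Exec (.seq c₁ c₂) M (t₁ + t₂) M''
  | ite_true {e : Expr} {c₁ c₂ : Cmd} {M M' : Mem} {t : ℕ}
      (he : e.eval M ≠ 0) (h : Exec c₁ M t M') :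
      Exec (.ite e c₁ c₂) M (e.cost M + 1 + t) M'
  | ite_false {e : Expr} {c₁ c₂ : Cmd} {M M' : Mem} {t : ℕ}
      (he : e.eval M = 0) (h : Exec c₂ M t M') :
      Exec (.ite e c₁ c₂) M (e.cost M + 1 + t) M'
  | loop_done {e : Expr} {c : Cmd} {M : Mem} (he : e.eval M = 0) :
      Exec (.loop e c) M (e.cost M + 1) M
  | loop_step {e : Expr} {c : Cmd} {M M' M'' : Mem} {t₁ t₂ : ℕ}
      (he : e.eval M ≠ 0) (h₁ : Exec c M t₁ M') (h₂ : Exec (.loop e c) M' t₂ M'') :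
      Exec (.loop e c) M (e.cost M + 1 + t₁ + t₂) M''

/-- Initial memory: the input words are in bank `0`, every other cell is `0`. -/
def initMem (w : List ℕ) : Mem :=
  fun x i => if x = 0 then w.getD i 0 else 0

/-- The output is read from bank `1`: cell `0` holds its length, cells `1, 2, …` its entries. -/
def output (M : Mem) : List ℕ :=
  (List.range (M 1 0)).map fun i => M 1 (i + 1)

/-- Number of symbols needed to write a list of natural numbers in binary, with separators. -/
def wordSize (w : List ℕ) : ℕ :=
  (w.map fun n => Nat.size n + 1).sum

end RAM

/-! ## Minimization problems and fully polynomial time approximation schemes -/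

/-- A minimization problem: instances, feasible solutions, objective values, the encoding of
instances as words, and which output words describe which solution. -/
structure MinProblem where
  Inst : Type
  Sol : Inst → Type
  value : (I : Inst) → Sol I → ℚ
  encode : Inst → List ℕ
  Describes : (I : Inst) → List ℕ → Sol I → Prop

/-- Fully polynomial time approximation scheme: a single program that, for every instance `I` and
every `ε > 0`, outputs a feasible solution of value at most `(1 + ε)` times that of every feasible
solution, in time polynomial in the binary size of `I` and in `1 / ε`. A real number cannot be an
input; the program gets the required accuracy as the natural number `⌈1 / ε⌉`. -/
def MinProblem.AdmitsFPTAS (P : MinProblem) : Prop :=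
  ∃ (c : RAM.Cmd) (C d : ℕ), ∀ (I : P.Inst) (ε : ℝ), 0 < ε →
    ∃ (t : ℕ) (M : RAM.Mem),
      RAM.Exec c (RAM.initMem (⌈1 / ε⌉₊ :: P.encode I)) t M ∧
      (t : ℝ) ≤ C * ((RAM.wordSize (P.encode I) : ℝ) + 1 / ε) ^ d ∧
      ∃ S : P.Sol I, P.Describes I (RAM.output M) S ∧
        ∀ S' : P.Sol I, (P.value I S : ℝ) ≤ (1 + ε) * (P.value I S' : ℝ)

/-! ## Matching edge ejection tours -/

namespace MEE

/-- Vertices `U ∪ V`: `Sum.inl i` is `u_i` and `Sum.inr j` is `v_j`. -/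
abbrev Vert (r s : ℕ) : Type := Fin r ⊕ Fin s

/-- The edge `e_i = (u_i, u_{i+1})`, indices modulo `r`. -/
def cycEdge (r s : ℕ) (i : Fin r) : Sym2 (Vert r s) :=
  s(Sum.inl i, Sum.inl (finRotate r i))

/-- The edge `(u_i, v_j)`. -/
def crossEdge {r s : ℕ} (i : Fin r) (j : Fin s) : Sym2 (Vert r s) :=
  s(Sum.inl i, Sum.inr j)

/-- The graph `G^M`, with edge set `E_u ∪ E_uv`. -/
def graph (r s : ℕ) : SimpleGraph (Vert r s) :=
  SimpleGraph.fromEdgeSet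
    (Set.range (cycEdge r s) ∪ {e | ∃ (i : Fin r) (j : Fin s), e = crossEdge i j})

/-- The edges left and created when `e_{π(1)}, …, e_{π(s)}` are ejected from the cycle `E_u` and
each `v_j` is joined to the two end points of `e_{π(j)}`. -/
def ejectInsert {r s : ℕ} (π : Fin s ↪ Fin r) : Finset (Sym2 (Vert r s)) :=
  (Finset.univ.image (cycEdge r s) \ Finset.univ.image fun j => cycEdge r s (π j)) ∪
    Finset.univ.biUnion fun j => {crossEdge (π j) j, crossEdge (finRotate r (π j)) j}

/-- `F(MEE)`: the tours (edge sets of Hamiltonian cycles) of `G^M` obtained by ejecting `s` edges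
of the cycle `E_u` and inserting the vertices of `V` in their places. -/
def tours (r s : ℕ) : Set (Finset (Sym2 (Vert r s))) :=
  {τ | (∃ (u : Vert r s) (p : (graph r s).Walk u u),
          p.IsHamiltonianCycle ∧ p.edges.toFinset = τ) ∧
        ∃ π : Fin s ↪ Fin r, τ = ejectInsert π}

/-- An instance of the homogeneous rank 1 problem: a graph `G^M` (the cycle `E_u` has at least
three vertices, and `s ≤ r`) with nonnegative rational edge costs `a` and `b`. The values of `a`
and `b` off the edge set are irrelevant. -/
structure Instance where
  r : ℕ
  s : ℕ
  three_le : 3 ≤ r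
  s_le_r : s ≤ r
  a : Sym2 (Vert r s) → ℚ
  b : Sym2 (Vert r s) → ℚ
  a_nonneg : ∀ e ∈ (graph r s).edgeSet, 0 ≤ a e
  b_nonneg : ∀ e ∈ (graph r s).edgeSet, 0 ≤ b e

/-- The objective `q(τ) = (∑_{e ∈ τ} a_e) (∑_{e ∈ τ} b_e)`. -/
def Instance.objective (I : Instance) (τ : Finset (Sym2 (Vert I.r I.s))) : ℚ :=
  (∑ e ∈ τ, I.a e) * (∑ e ∈ τ, I.b e)

/-- The costs of an edge as four words: numerators and denominators of `a_e` and `b_e`. -/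
def Instance.edgeWords (I : Instance) (e : Sym2 (Vert I.r I.s)) : List ℕ :=
  [(I.a e).num.toNat, (I.a e).den, (I.b e).num.toNat, (I.b e).den]

/-- An instance as a list of words: `r`, `s`, the costs of `e_1, …, e_r`, then those of the edges
`(u_i, v_j)` in lexicographic order. -/
def Instance.encode (I : Instance) : List ℕ :=
  I.r :: I.s ::
    ((List.finRange I.r).flatMap (fun i => I.edgeWords (cycEdge I.r I.s i)) ++
      (List.finRange I.r).flatMap fun i =>
        (List.finRange I.s).flatMap fun j => I.edgeWords (crossEdge i j))

/-- Vertex numbers: the `u_i` get `0, …, r - 1`, the `v_j` get `r, …, r + s - 1`. -/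
def vertNum {r s : ℕ} : Vert r s → ℕ
  | Sum.inl i => i
  | Sum.inr j => r + j

/-- A list of words describes a tour if it lists the numbers of the vertices in the order in which
some Hamiltonian cycle with this edge set visits them. -/
def Describes {r s : ℕ} (w : List ℕ) (τ : Finset (Sym2 (Vert r s))) : Prop :=
  ∃ (u : Vert r s) (p : (graph r s).Walk u u),
    p.IsHamiltonianCycle ∧ p.edges.toFinset = τ ∧ w = p.support.tail.map vertNum

end MEE

/-- QTSP(1,H)-MEE with nonnegative costs. -/
def qtspRankOneMEE : MinProblem where
  Inst := MEE.Instance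
  Sol I := MEE.tours I.r I.s
  value I τ := I.objective τ.1
  encode I := I.encode
  Describes _ w τ := MEE.Describes w τ.1

/-! ## Reasoning about RAM programs -/

namespace RAM

/-! A tour is a linear assignment in disguise. The objects are the r cycle edges, the persons are 1,
…, r; person j ≤ s stands for v_j, the others are dummies. Giving e_i to v_j costs the two inserted
edges, giving it to a dummy costs e_i itself. Every tour is represented by an assignment and
conversely, and both factors of q become costs of the same assignment, up to the constant that
clears denominators (`Instance.entryCost_mul_entryCost`).

To minimize a product AB, let n = ⌈1/ε⌉, guess the costs A', B' of a competitor by α, β up to a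
factor 1 + 1/(4n), and minimize the linear cost A/α + B/β instead. The competitor achieves at most 2
+ 1/(2n), and the AM-GM inequality turns near-optimality for the sum into AB ≤ (1 + 1/n) A'B'
(`product_le_of_scaled`). The guesses range over a geometric grid; O(n log S) points suffice when S
bounds all costs (`exists_fits`, `two_pow_le_grid`).

The linear problem is solved only approximately. Its weights are multiplied by K = 12rn, rounded
down and capped at 4K, hence are integers polynomial in r and n. The auction algorithm with bid
increment 1, whose number of bids is linear in the largest weight, then makes polynomially many bids
(`AuctionState.bids_le`) and ends within r of the optimum (`AuctionState.sum_le`), an error that is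
small against K/n.

For the running time, `Runs` counts elementary steps while keeping every stored word within b bits,
so the logarithmic cost is at most steps times b + 1 times a constant of the program. The common
multiple of the denominators is at most 2 to the input length, so words of linear length suffice
(`scheme_bounds`). -/

theorem size_le_of_lt_two_pow {m b : ℕ} (h : m < 2 ^ b) : m.size ≤ b := Nat.size_le.2 h

theorem size_le_self (n : ℕ) : n.size ≤ n := Nat.size_le.2 Nat.lt_two_pow_self

theorem size_eval_le (o : Op) (m n : ℕ) : (o.eval m n).size ≤ m.size + n.size + 1 := by
  have hm := Nat.lt_size_self m
  have hn := Nat.lt_size_self n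
  cases o with
  | add =>
    refine Nat.size_le.2 ?_
    have h1 : 2 ^ m.size ≤ 2 ^ (m.size + n.size) := Nat.pow_le_pow_right (by norm_num) (by omega)
    have h2 : 2 ^ n.size ≤ 2 ^ (m.size + n.size) := Nat.pow_le_pow_right (by norm_num) (by omega)
    simp only [Op.eval, pow_succ]
    omega
  | sub => exact (Nat.size_le_size (Nat.sub_le m n)).trans (by omega)
  | mul =>
    have : m * n < 2 ^ (m.size + n.size) := by
      rw [pow_add]
      exact Nat.mul_lt_mul'' hm hn
    exact (Nat.size_le.2 this).trans (by omega)
  | div => exact (Nat.size_le_size (Nat.div_le_self m n)).trans (by omega)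

/-- All cells hold numbers of at most `b` bits. -/
def Bounded (b : ℕ) (M : Mem) : Prop := ∀ x i, M x i < 2 ^ b

/-- The cost of an expression in a memory of `b`-bit words is at most `weight * (b + 1)`. -/
def Expr.weight : Expr → ℕ
  | .lit n => 2 * n + 1
  | .get _ i => i.weight + 2
  | .bin _ e f => 3 * (e.weight + f.weight) + 3

/-- Intermediate results may exceed b bits, but an operation yields at most the sum of the operand
lengths plus one, so the excess is a factor fixed by the expression. The length of the value is
added to the cost to make the induction go through. -/
theorem Expr.cost_add_size_le {b : ℕ} {M : Mem} (hM : Bounded b M) (e : Expr) :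
    e.cost M + (e.eval M).size ≤ e.weight * (b + 1) := by
  induction e with
  | lit n =>
    simp only [Expr.cost, Expr.eval, Expr.weight]
    have := size_le_self n
    nlinarith
  | get x i ih =>
    simp only [Expr.cost, Expr.eval, Expr.weight]
    have := size_le_of_lt_two_pow (hM x (i.eval M))
    nlinarith
  | bin o e f he hf =>
    simp only [Expr.cost, Expr.eval, Expr.weight]
    have := size_eval_le o (e.eval M) (f.eval M)
    nlinarith

/-- The largest weight of an elementary step of a program. -/
def Cmd.weight : Cmd → ℕ
  | .skip => 1
  | .set _ i e => i.weight + e.weight + 1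
  | .seq c d => max c.weight d.weight
  | .ite e c d => max (e.weight + 1) (max c.weight d.weight)
  | .loop e c => max (e.weight + 1) c.weight

/-- The banks a program may write to. -/
def Cmd.writes : Cmd → List ℕ
  | .skip => []
  | .set x _ _ => [x]
  | .seq c d => c.writes ++ d.writes
  | .ite _ c d => c.writes ++ d.writes
  | .loop _ c => c.writes

/-- The means by which facts about data survive later program pieces: whether a bank is written to
is decided from the syntax alone. -/
theorem Exec.frame {c : Cmd} {M M' : Mem} {t : ℕ} (h : Exec c M t M') :
    ∀ x, x ∉ c.writes → M' x = M x := by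
  induction h with
  | skip M => intro x _; rfl
  | set M y i e =>
    intro x hx
    funext j
    simp only [Cmd.writes, List.mem_singleton] at hx
    simp [Mem.write, hx]
  | seq _ _ ih₁ ih₂ =>
    intro x hx
    simp only [Cmd.writes, List.mem_append, not_or] at hx
    rw [ih₂ x hx.2, ih₁ x hx.1]
  | ite_true _ _ ih =>
    intro x hx
    simp only [Cmd.writes, List.mem_append, not_or] at hx
    exact ih x hx.1
  | ite_false _ _ ih =>
    intro x hx
    simp only [Cmd.writes, List.mem_append, not_or] at hx
    exact ih x hx.2
  | loop_done _ => intro x _; rfl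
  | loop_step _ _ _ ih₁ ih₂ =>
    intro x hx
    rw [ih₂ x hx, ih₁ x hx]

/-- `Runs b c M T Q`: in a memory of `b`-bit words, `c` halts after at most `T` elementary steps,
never writes a longer word, and ends in a memory satisfying `Q`. -/
def Runs (b : ℕ) (c : Cmd) (M : Mem) (T : ℕ) (Q : Mem → Prop) : Prop :=
  Bounded b M → ∃ t M', Exec c M t M' ∧ t ≤ T * (c.weight * (b + 1)) ∧ Bounded b M' ∧ Q M'

namespace Runs

variable {b T T₁ T₂ : ℕ} {c d : Cmd} {e : Expr} {M : Mem} {P Q : Mem → Prop}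

theorem mono (h : Runs b c M T₁ P) (hT : T₁ ≤ T₂) (hPQ : ∀ M', P M' → Q M') :
    Runs b c M T₂ Q := by
  intro hM
  obtain ⟨t, M', h₁, h₂, h₃, h₄⟩ := h hM
  exact ⟨t, M', h₁, h₂.trans (Nat.mul_le_mul_right _ hT), h₃, hPQ M' h₄⟩

/-- Banks that are not written to keep their content. -/
theorem framed (h : Runs b c M T Q) :
    Runs b c M T (fun M' => Q M' ∧ ∀ x, x ∉ c.writes → M' x = M x) := by
  intro hM
  obtain ⟨t, M', h₁, h₂, h₃, h₄⟩ := h hM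
  exact ⟨t, M', h₁, h₂, h₃, h₄, h₁.frame⟩

theorem skip (h : Q M) : Runs b .skip M 1 Q := by
  intro hM
  refine ⟨1, M, .skip M, ?_, hM, h⟩
  simp [Cmd.weight]

theorem set {x : ℕ} {i e : Expr} (he : e.eval M < 2 ^ b)
    (h : Q (M.write x (i.eval M) (e.eval M))) : Runs b (.set x i e) M 1 Q := by
  intro hM
  refine ⟨_, _, .set M x i e, ?_, ?_, h⟩
  · have h₁ := i.cost_add_size_le hM
    have h₂ := e.cost_add_size_le hM
    simp only [Cmd.weight]
    nlinarith
  · intro y j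
    unfold Mem.write
    split_ifs
    · exact he
    · exact hM y j

theorem seq (h₁ : Runs b c M T₁ P) (h₂ : ∀ M', P M' → Runs b d M' T₂ Q) :
    Runs b (.seq c d) M (T₁ + T₂) Q := by
  intro hM
  obtain ⟨t, M', e₁, le₁, b₁, q₁⟩ := h₁ hM
  obtain ⟨t', M'', e₂, le₂, b₂, q₂⟩ := h₂ M' q₁ b₁
  refine ⟨t + t', M'', .seq e₁ e₂, ?_, b₂, q₂⟩
  rw [add_mul]
  refine add_le_add (le₁.trans ?_) (le₂.trans ?_)
  · exact Nat.mul_le_mul_left _ (Nat.mul_le_mul_right _ (le_max_left _ _))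
  · exact Nat.mul_le_mul_left _ (Nat.mul_le_mul_right _ (le_max_right _ _))

theorem ite (h₁ : e.eval M ≠ 0 → Runs b c M T Q) (h₂ : e.eval M = 0 → Runs b d M T Q) :
    Runs b (.ite e c d) M (T + 1) Q := by
  intro hM
  have hc : e.cost M + 1 ≤ (Cmd.ite e c d).weight * (b + 1) := by
    have h := e.cost_add_size_le hM
    have h' : (e.weight + 1) * (b + 1) ≤ (Cmd.ite e c d).weight * (b + 1) :=
      Nat.mul_le_mul_right _ (le_max_left _ _)
    nlinarith
  by_cases he : e.eval M = 0
  · obtain ⟨t, M', e₁, le₁, b₁, q₁⟩ := h₂ he hM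
    refine ⟨_, M', .ite_false he e₁, ?_, b₁, q₁⟩
    have : d.weight * (b + 1) ≤ (Cmd.ite e c d).weight * (b + 1) :=
      Nat.mul_le_mul_right _ ((le_max_right _ _).trans (le_max_right _ _))
    have := Nat.mul_le_mul_left T this
    nlinarith
  · obtain ⟨t, M', e₁, le₁, b₁, q₁⟩ := h₁ he hM
    refine ⟨_, M', .ite_true he e₁, ?_, b₁, q₁⟩
    have : c.weight * (b + 1) ≤ (Cmd.ite e c d).weight * (b + 1) :=
      Nat.mul_le_mul_right _ ((le_max_left _ _).trans (le_max_right _ _))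
    have := Nat.mul_le_mul_left T this
    nlinarith

/-- A loop whose `k`-th pass starts in a memory satisfying `Inv k` and that makes at most `G`
passes. -/
theorem loop_aux {Inv : ℕ → Mem → Prop} {G k : ℕ}
    (step : ∀ k M, Inv k M → e.eval M ≠ 0 → k < G ∧ Runs b c M T (Inv (k + 1)))
    (hk : Inv k M) :
    Runs b (.loop e c) M ((G - k) * (T + 1) + 1) (fun M' => ∃ l, Inv l M' ∧ e.eval M' = 0) := by
  generalize hm : G - k = m
  induction m generalizing k M with
  | zero =>
    intro hM
    have he : e.eval M = 0 := by
      by_contra he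
      have := (step k M hk he).1
      omega
    refine ⟨_, M, .loop_done he, ?_, hM, k, hk, he⟩
    have h := e.cost_add_size_le hM
    have h' : (e.weight + 1) * (b + 1) ≤ (Cmd.loop e c).weight * (b + 1) :=
      Nat.mul_le_mul_right _ (le_max_left _ _)
    nlinarith
  | succ m ih =>
    intro hM
    have hc : e.cost M + 1 ≤ (Cmd.loop e c).weight * (b + 1) := by
      have h := e.cost_add_size_le hM
      have h' : (e.weight + 1) * (b + 1) ≤ (Cmd.loop e c).weight * (b + 1) :=
        Nat.mul_le_mul_right _ (le_max_left _ _)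
      nlinarith
    by_cases he : e.eval M = 0
    · refine ⟨_, M, .loop_done he, hc.trans ?_, hM, k, hk, he⟩
      nlinarith [Nat.zero_le ((m + 1) * (T + 1) * ((Cmd.loop e c).weight * (b + 1)))]
    · obtain ⟨t, M', e₁, le₁, b₁, q₁⟩ := (step k M hk he).2 hM
      obtain ⟨t', M'', e₂, le₂, b₂, q₂⟩ := ih q₁ (by omega) b₁
      refine ⟨_, M'', .loop_step he e₁ e₂, ?_, b₂, q₂⟩
      have : c.weight * (b + 1) ≤ (Cmd.loop e c).weight * (b + 1) :=
        Nat.mul_le_mul_right _ (le_max_right _ _)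
      have := Nat.mul_le_mul_left T this
      nlinarith

/-- A loop whose `k`-th pass starts in a memory satisfying `Inv k` and that makes at most `G`
passes; banks that the body does not write to are unchanged throughout. -/
theorem loop {Inv : ℕ → Mem → Prop} {G k : ℕ}
    (step : ∀ k M', (∀ x, x ∉ c.writes → M' x = M x) → Inv k M' → e.eval M' ≠ 0 →
      k < G ∧ Runs b c M' T (Inv (k + 1)))
    (hk : Inv k M) :
    Runs b (.loop e c) M ((G - k) * (T + 1) + 1)
      (fun M' => (∀ x, x ∉ c.writes → M' x = M x) ∧ ∃ l, Inv l M' ∧ e.eval M' = 0) := by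
  refine (loop_aux (Inv := fun k M' => (∀ x, x ∉ c.writes → M' x = M x) ∧ Inv k M') (G := G)
    (T := T) ?_ ⟨fun _ _ => rfl, hk⟩).mono le_rfl ?_
  · rintro k M' ⟨hf, hI⟩ he
    obtain ⟨h₁, h₂⟩ := step k M' hf hI he
    exact ⟨h₁, h₂.framed.mono le_rfl fun M'' h => ⟨fun x hx => (h.2 x hx).trans (hf x hx), h.1⟩⟩
  · rintro M' ⟨l, ⟨hf, hI⟩, he⟩
    exact ⟨hf, l, hI, he⟩

/-- A loop over `k = k₀, …, n - 1`. -/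
theorem loop_upto {Inv : ℕ → Mem → Prop} {n k₀ : ℕ} (hk₀ : k₀ ≤ n)
    (guard : ∀ k M', (∀ x, x ∉ c.writes → M' x = M x) → Inv k M' → e.eval M' = n - k)
    (step : ∀ k M', (∀ x, x ∉ c.writes → M' x = M x) → k < n → Inv k M' →
      Runs b c M' T (Inv (k + 1)))
    (h : Inv k₀ M) : Runs b (.loop e c) M ((n - k₀) * (T + 1) + 1)
      (fun M' => (∀ x, x ∉ c.writes → M' x = M x) ∧ Inv n M') := by
  refine (loop (Inv := fun k M => k ≤ n ∧ Inv k M) (G := n) (T := T) ?_ ⟨hk₀, h⟩).mono le_rfl ?_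
  · rintro k M hf ⟨hk, hI⟩ he
    have := guard k M hf hI
    have hlt : k < n := by omega
    exact ⟨hlt, (step k M hf hlt hI).mono le_rfl fun M' h' => ⟨hlt, h'⟩⟩
  · rintro M' ⟨hf, l, ⟨hl, hI⟩, he⟩
    have := guard l M' hf hI
    obtain rfl : l = n := by omega
    exact ⟨hf, hI⟩

end Runs

/-! ### Notation for expressions -/

instance : Add Expr := ⟨.bin .add⟩
instance : Sub Expr := ⟨.bin .sub⟩
instance : Mul Expr := ⟨.bin .mul⟩
instance : Div Expr := ⟨.bin .div⟩

/-- Cell `0` of bank `x`, used as a scalar variable. -/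
def var (x : ℕ) : Expr := .get x (.lit 0)

/-- Assignment to a scalar variable. -/
def assign (x : ℕ) (e : Expr) : Cmd := .set x (.lit 0) e

section eval

variable (M : Mem) (e f : Expr)

@[simp] theorem Expr.eval_lit (n : ℕ) : (Expr.lit n).eval M = n := rfl
@[simp] theorem Expr.eval_get (x : ℕ) : (Expr.get x e).eval M = M x (e.eval M) := rfl
@[simp] theorem Expr.eval_add : (e + f).eval M = e.eval M + f.eval M := rfl
@[simp] theorem Expr.eval_sub : (e - f).eval M = e.eval M - f.eval M := rfl
@[simp] theorem Expr.eval_mul : (e * f).eval M = e.eval M * f.eval M := rfl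
@[simp] theorem Expr.eval_div : (e / f).eval M = e.eval M / f.eval M := rfl
@[simp] theorem eval_var (x : ℕ) : (var x).eval M = M x 0 := rfl

theorem Mem.write_apply (x i v y j : ℕ) :
    M.write x i v y j = if y = x ∧ j = i then v else M y j := rfl

@[simp] theorem Mem.write_self (x i v : ℕ) : M.write x i v x i = v := by simp [Mem.write]

theorem Mem.write_of_ne {x y : ℕ} (i v : ℕ) (h : y ≠ x) : M.write x i v y = M y := by
  funext j; simp [Mem.write, h]

end eval

theorem Runs.assign {b x : ℕ} {e : Expr} {M : Mem} {Q : Mem → Prop} (he : e.eval M < 2 ^ b)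
    (h : Q (M.write x 0 (e.eval M))) : Runs b (RAM.assign x e) M 1 Q :=
  Runs.set he h

theorem Runs.set_seq {b x T : ℕ} {i e : Expr} {c : Cmd} {M : Mem} {Q : Mem → Prop}
    (he : e.eval M < 2 ^ b) (h : Runs b c (M.write x (i.eval M) (e.eval M)) T Q) :
    Runs b (.seq (.set x i e) c) M (1 + T) Q :=
  Runs.seq (P := fun M' => M' = M.write x (i.eval M) (e.eval M)) (Runs.set he rfl)
    fun _ h' => h' ▸ h

theorem Runs.assign_seq {b x T : ℕ} {e : Expr} {c : Cmd} {M : Mem} {Q : Mem → Prop}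
    (he : e.eval M < 2 ^ b) (h : Runs b c (M.write x 0 (e.eval M)) T Q) :
    Runs b (.seq (RAM.assign x e) c) M (1 + T) Q :=
  Runs.set_seq he h

end RAM

/-! ## The auction algorithm for the assignment problem -/

/-- `o` assigns to the objects `0, …, r - 1` the persons `1, …, r`, bijectively. -/
def IsAssignment (r : ℕ) (o : ℕ → ℕ) : Prop :=
  (∀ i < r, 1 ≤ o i ∧ o i ≤ r) ∧ Set.InjOn o (Set.Iio r)

namespace IsAssignment

variable {r : ℕ} {o : ℕ → ℕ}

theorem image_eq (ho : IsAssignment r o) : (Finset.range r).image o = Finset.Icc 1 r := by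
  refine Finset.eq_of_subset_of_card_le ?_ ?_
  · intro j hj
    obtain ⟨i, hi, rfl⟩ := Finset.mem_image.1 hj
    exact Finset.mem_Icc.2 (ho.1 i (Finset.mem_range.1 hi))
  · rw [Finset.card_image_of_injOn (by simpa using ho.2)]
    simp

theorem sum_comp (ho : IsAssignment r o) (f : ℕ → ℕ) :
    ∑ i ∈ Finset.range r, f (o i) = ∑ j ∈ Finset.Icc 1 r, f j := by
  rw [← ho.image_eq, Finset.sum_image (by simpa using ho.2)]

theorem exists_eq (ho : IsAssignment r o) {j : ℕ} (h₁ : 1 ≤ j) (h₂ : j ≤ r) :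
    ∃ i < r, o i = j := by
  have : j ∈ (Finset.range r).image o := by rw [ho.image_eq]; exact Finset.mem_Icc.2 ⟨h₁, h₂⟩
  simpa using this

end IsAssignment

/-- Almost complementary slackness implies almost optimality. -/
theorem sum_le_of_slackness {r : ℕ} {o σ p : ℕ → ℕ} {w : ℕ → ℕ → ℕ}
    (ho : IsAssignment r o) (hσ : IsAssignment r σ)
    (hs : ∀ i < r, ∀ i' < r, w (o i) i + p i ≤ w (o i) i' + p i' + 1) :
    ∑ i ∈ Finset.range r, w (o i) i ≤ ∑ i ∈ Finset.range r, w (σ i) i + r := by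
  -- Linear programming duality: with prices p, the numbers u j = min over i of w j i + p i are dual
  -- variables. The sum of u plus the negated prices bounds every assignment from below, and o
  -- exceeds it by at most 1 per object.
  have hu : ∀ j, ∃ u, (∀ i < r, u ≤ w j i + p i) ∧ (0 < r → ∃ i < r, u = w j i + p i) := by
    intro j
    rcases Nat.eq_zero_or_pos r with rfl | hr
    · exact ⟨0, by simp, by simp⟩
    · obtain ⟨i, hi, hmin⟩ := Finset.exists_min_image (Finset.range r) (fun i => w j i + p i)
        ⟨0, by simpa using hr⟩
      exact ⟨w j i + p i, fun i' hi' => hmin i' (by simpa using hi'),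
        fun _ => ⟨i, by simpa using hi, rfl⟩⟩
  choose u hu₁ hu₂ using hu
  have h₁ : ∑ i ∈ Finset.range r, (w (o i) i + p i) ≤ ∑ i ∈ Finset.range r, (u (o i) + 1) := by
    refine Finset.sum_le_sum fun i hi => ?_
    have hi := Finset.mem_range.1 hi
    obtain ⟨i', hi', h⟩ := hu₂ (o i) (by omega)
    rw [h]
    exact hs i hi i' hi'
  have h₂ : ∑ i ∈ Finset.range r, u (σ i) ≤ ∑ i ∈ Finset.range r, (w (σ i) i + p i) :=
    Finset.sum_le_sum fun i hi => hu₁ _ i (Finset.mem_range.1 hi)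
  rw [Finset.sum_add_distrib, Finset.sum_add_distrib, ho.sum_comp u] at h₁
  rw [Finset.sum_add_distrib, hσ.sum_comp u] at h₂
  simp only [Finset.sum_const, Finset.card_range, smul_eq_mul, mul_one] at h₁
  omega

/-- The state of the auction after `k` bids: `cnt` objects are owned, `cur` is the bidder, `o i` is
the owner of object `i` (or `0`) and `p i` its price. -/
structure AuctionState (r W : ℕ) (w : ℕ → ℕ → ℕ) (k cnt cur : ℕ) (o p : ℕ → ℕ) : Prop where
  cnt_le : cnt ≤ r
  one_le_cur : 1 ≤ cur
  cur_le : cur ≤ cnt + 1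
  cur_of_eq : cnt = r → cur = r + 1
  sum_price : ∑ i ∈ Finset.range r, p i = k
  price_le : ∀ i < r, p i ≤ W + 1
  price_eq_zero : ∀ i < r, o i = 0 → p i = 0
  owner_le : ∀ i < r, o i ≤ cnt + 1
  owner_ne : ∀ i < r, o i ≠ cur
  inj : ∀ i < r, ∀ i' < r, o i ≠ 0 → o i = o i' → i = i'
  card_owned : ((Finset.range r).filter fun i => o i ≠ 0).card = cnt
  slack : ∀ i < r, o i ≠ 0 → ∀ i' < r, w (o i) i + p i ≤ w (o i) i' + p i' + 1

namespace AuctionState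

variable {r W k cnt cur i₀ : ℕ} {w : ℕ → ℕ → ℕ} {o p o' p' : ℕ → ℕ}

theorem init (hr : 0 < r) (ho : ∀ i < r, o i = 0) (hp : ∀ i < r, p i = 0) :
    AuctionState r W w 0 0 1 o p where
  cnt_le := Nat.zero_le _
  one_le_cur := le_rfl
  cur_le := le_rfl
  cur_of_eq h := by omega
  sum_price := Finset.sum_eq_zero fun i hi => hp i (Finset.mem_range.1 hi)
  price_le i hi := by simp [hp i hi]
  price_eq_zero i hi _ := hp i hi
  owner_le i hi := by simp [ho i hi]
  owner_ne i hi := by simp [ho i hi]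
  inj i hi _ _ h := absurd (ho i hi) h
  card_owned := by
    rw [Finset.card_eq_zero, Finset.filter_eq_empty_iff]
    intro i hi
    simp [ho i (Finset.mem_range.1 hi)]
  slack i hi h := absurd (ho i hi) h

theorem exists_free (h : AuctionState r W w k cnt cur o p) (hlt : cnt < r) :
    ∃ i < r, o i = 0 := by
  by_contra! hne
  have : (Finset.range r).filter (fun i => o i ≠ 0) = Finset.range r :=
    Finset.filter_true_of_mem fun i hi => hne i (Finset.mem_range.1 hi)
  have h' := h.card_owned
  rw [this, Finset.card_range] at h'
  omega

/-- Each bid raises exactly one price by 1, so the sum of the prices counts the bids; this is what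
makes the auction terminate. -/
theorem bids_le (h : AuctionState r W w k cnt cur o p) : k ≤ r * (W + 1) := by
  rw [← h.sum_price]
  refine (Finset.sum_le_card_nsmul _ _ (W + 1) fun i hi => h.price_le i (Finset.mem_range.1 hi)).trans ?_
  simp

/-- One bid: `cur` gets the object `i₀` that is cheapest for it. -/
theorem bid (h : AuctionState r W w k cnt cur o p) (hlt : cnt < r) (hw : ∀ j i, w j i ≤ W)
    (hi₀ : i₀ < r) (hmin : ∀ i < r, w cur i₀ + p i₀ ≤ w cur i + p i)
    (ho' : ∀ i < r, o' i = if i = i₀ then cur else o i)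
    (hp' : ∀ i < r, p' i = if i = i₀ then p i₀ + 1 else p i) :
    AuctionState r W w (k + 1) (if o i₀ = 0 then cnt + 1 else cnt)
      (if o i₀ = 0 then cnt + 2 else o i₀) o' p' := by
  have hc₁ := h.one_le_cur
  have hc₂ := h.cur_le
  have hpp : ∀ i < r, p i ≤ p' i := by
    intro i hi
    rw [hp' i hi]
    split_ifs with hii
    · subst hii; omega
    · exact le_rfl
  -- Some object is still free and has price 0, so it is available to the bidder for at most W; the
  -- cheapest object cannot have a larger price. After the bid the price is at most W + 1.
  have hp₀ : p i₀ ≤ W := by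
    obtain ⟨i, hi, hf⟩ := h.exists_free hlt
    have h₁ := hmin i hi
    have h₂ := h.price_eq_zero i hi hf
    have h₃ := hw cur i
    omega
  have hsum : ∑ i ∈ Finset.range r, p' i = k + 1 := by
    rw [Finset.sum_congr rfl fun i hi => hp' i (Finset.mem_range.1 hi), ← h.sum_price,
      ← Finset.add_sum_erase _ _ (Finset.mem_range.2 hi₀),
      ← Finset.add_sum_erase _ p (Finset.mem_range.2 hi₀)]
    have : ∑ x ∈ (Finset.range r).erase i₀, (if x = i₀ then p i₀ + 1 else p x) =
        ∑ x ∈ (Finset.range r).erase i₀, p x :=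
      Finset.sum_congr rfl fun i hi => if_neg (Finset.ne_of_mem_erase hi)
    rw [this]
    simp
    omega
  have howned : (Finset.range r).filter (fun i => o' i ≠ 0) =
      insert i₀ ((Finset.range r).filter fun i => o i ≠ 0) := by
    ext i
    simp only [Finset.mem_filter, Finset.mem_range, Finset.mem_insert]
    constructor
    · rintro ⟨hi, hne⟩
      rw [ho' i hi] at hne
      by_cases hii : i = i₀
      · exact Or.inl hii
      · rw [if_neg hii] at hne; exact Or.inr ⟨hi, hne⟩
    · rintro (rfl | ⟨hi, hne⟩)
      · refine ⟨hi₀, ?_⟩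
        rw [ho' i hi₀, if_pos rfl]; omega
      · refine ⟨hi, ?_⟩
        rw [ho' i hi]
        split_ifs <;> omega
  refine
    { cnt_le := by split_ifs <;> omega
      one_le_cur := by split_ifs <;> omega
      cur_le := by have := h.owner_le i₀ hi₀; split_ifs <;> omega
      cur_of_eq := by split_ifs <;> omega
      sum_price := hsum
      price_le := ?_
      price_eq_zero := ?_
      owner_le := ?_
      owner_ne := ?_
      inj := ?_
      card_owned := ?_
      slack := ?_ }
  · intro i hi
    rw [hp' i hi]
    have := h.price_le i hi
    split_ifs <;> omega
  · intro i hi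
    rw [hp' i hi, ho' i hi]
    have := h.price_eq_zero i hi
    split_ifs <;> omega
  · intro i hi
    rw [ho' i hi]
    have := h.owner_le i hi
    split_ifs <;> omega
  · intro i hi
    rw [ho' i hi]
    have h₁ := h.owner_le i hi
    have h₂ := h.owner_ne i₀ hi₀
    have h₃ := h.inj i₀ hi₀ i hi
    split_ifs with hii <;> omega
  · intro i hi i' hi'
    rw [ho' i hi, ho' i' hi']
    have h₁ := h.inj i hi i' hi'
    have h₂ := h.owner_ne i hi
    have h₃ := h.owner_ne i' hi'
    split_ifs <;> omega
  · rw [howned]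
    split_ifs with h0
    · rw [Finset.card_insert_of_notMem (by simp [h0]), h.card_owned]
    · rw [Finset.insert_eq_of_mem (by simp [h0, hi₀]), h.card_owned]
  -- The new owner chose a cheapest object and then its price rose by 1, which uses up the slack of
  -- 1. For the other owners only prices of competing objects have risen.
  · intro i hi hne i' hi'
    have h₁ := hpp i' hi'
    rw [ho' i hi] at hne ⊢
    rw [hp' i hi]
    by_cases hii : i = i₀
    · subst hii
      simp only [if_true]
      have := hmin i' hi'
      omega
    · rw [if_neg hii] at hne
      simp only [if_neg hii]
      have := h.slack i hi hne i' hi'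
      omega

/-- When all objects are owned, the bidder is the fictitious person r + 1. Owners are at most r + 1
and differ from the bidder, so they are genuine persons. -/
theorem isAssignment (h : AuctionState r W w k cnt cur o p) (hcnt : cnt = r) :
    IsAssignment r o := by
  have hne : ∀ i < r, o i ≠ 0 := by
    have h₁ := h.card_owned
    rw [hcnt] at h₁
    have : (Finset.range r).filter (fun i => o i ≠ 0) = Finset.range r :=
      Finset.eq_of_subset_of_card_le (Finset.filter_subset _ _) (by simp [h₁])
    intro i hi
    have h₂ : i ∈ (Finset.range r).filter fun i => o i ≠ 0 := by
      rw [this]; exact Finset.mem_range.2 hi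
    exact (Finset.mem_filter.1 h₂).2
  refine ⟨fun i hi => ?_, fun i hi i' hi' hii => h.inj i hi i' hi' (hne i hi) hii⟩
  have h₁ := hne i hi
  have h₂ := h.owner_le i hi
  have h₃ := h.owner_ne i hi
  have h₄ := h.cur_of_eq hcnt
  omega

theorem sum_le (h : AuctionState r W w k cnt cur o p) (hcnt : cnt = r) {σ : ℕ → ℕ}
    (hσ : IsAssignment r σ) :
    ∑ i ∈ Finset.range r, w (o i) i ≤ ∑ i ∈ Finset.range r, w (σ i) i + r := by
  have ho := h.isAssignment hcnt
  refine sum_le_of_slackness (p := p) ho hσ fun i hi => h.slack i hi ?_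
  have := ho.1 i hi
  omega

end AuctionState

/-! ## Scaled weights and the geometric grid -/

/-- `α` is a good guess for `A`, with relative accuracy `1 / N`. -/
def Fits (N α A : ℕ) : Prop := A * N ≤ α * (N + 1) ∧ (α ≤ A ∨ α = 1 ∧ A = 0)

/-- The scaled, rounded and capped weight of an entry with costs `x` and `y`. -/
def scaledWeight (K α β x y : ℕ) : ℕ := 4 * K - (4 * K - (K * x / α + K * y / β))

/-- Nested truncated subtraction is the machine's way of taking a minimum. -/
theorem scaledWeight_eq (K α β x y : ℕ) :
    scaledWeight K α β x y = min (4 * K) (K * x / α + K * y / β) := by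
  unfold scaledWeight
  generalize K * x / α + K * y / β = z
  omega

/-- The points `1 = x₀ < x₁ < …` of the grid of guesses. -/
def grid (N : ℕ) : ℕ → ℕ
  | 0 => 1
  | k + 1 => grid N k + grid N k / N + 1

theorem one_le_grid (N k : ℕ) : 1 ≤ grid N k := by
  cases k with
  | zero => exact le_rfl
  | succ k => simp [grid]

theorem grid_lt_succ (N k : ℕ) : grid N k < grid N (k + 1) := by
  simp only [grid, Nat.lt_succ_iff]
  exact Nat.le_add_right _ _

theorem grid_mono (N : ℕ) : Monotone (grid N) :=
  monotone_nat_of_le_succ fun k => (grid_lt_succ N k).le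

theorem lt_grid (N k : ℕ) : k < grid N k := by
  induction k with
  | zero => exact one_le_grid N 0
  | succ k ih => have := grid_lt_succ N k; omega

theorem grid_add_le {N : ℕ} (k l : ℕ) :
    grid N k + l * (grid N k / N + 1) ≤ grid N (k + l) := by
  induction l with
  | zero => simp
  | succ l ih =>
    have h : grid N k / N ≤ grid N (k + l) / N := Nat.div_le_div_right (grid_mono N (by omega))
    rw [← add_assoc]
    simp only [grid]
    nlinarith

/-- From any grid point x, each of the next N increments is at least x / N + 1 (rounded down), and
together they exceed x: the grid doubles within N steps. -/
theorem two_pow_le_grid {N : ℕ} (hN : 0 < N) (l : ℕ) : 2 ^ l ≤ grid N (N * l) := by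
  induction l with
  | zero => exact one_le_grid N _
  | succ l ih =>
    have h := grid_add_le (N := N) (N * l) N
    have h' := Nat.lt_mul_div_succ (grid N (N * l)) hN
    rw [mul_add, mul_one, pow_succ]
    nlinarith

/-- For A > 0 take the last grid point not exceeding A: the next one is larger than A, which bounds
the ratio by 1 + 1/N. For A = 0 the point 1 serves by convention. -/
theorem exists_fits {N A S : ℕ} (hA : A ≤ S) (hS : 1 ≤ S) :
    ∃ k, grid N k ≤ S ∧ Fits N (grid N k) A := by
  rcases Nat.eq_zero_or_pos A with rfl | hpos
  · exact ⟨0, hS, by simp, Or.inr ⟨rfl, rfl⟩⟩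
  · obtain ⟨k, hk⟩ : ∃ k, Nat.find (⟨A, lt_grid N A⟩ : ∃ k, A < grid N k) = k + 1 := by
      refine Nat.exists_eq_succ_of_ne_zero fun h0 => ?_
      have := Nat.find_spec (⟨A, lt_grid N A⟩ : ∃ k, A < grid N k)
      rw [h0] at this
      simp only [grid] at this
      omega
    have h₁ := Nat.find_spec (⟨A, lt_grid N A⟩ : ∃ k, A < grid N k)
    have h₂ := Nat.find_min (⟨A, lt_grid N A⟩ : ∃ k, A < grid N k) (m := k) (by omega)
    rw [hk] at h₁
    simp only [grid] at h₁
    have h₃ := Nat.div_mul_le_self (grid N k) N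
    refine ⟨k, by omega, ?_, Or.inl (by omega)⟩
    nlinarith

theorem natCast_div_le_floor_add_one (x y : ℕ) (hy : 0 < y) : (x : ℚ) / y ≤ (x / y : ℕ) + 1 := by
  have : (0 : ℚ) < y := by exact_mod_cast hy
  rw [div_le_iff₀ this]
  exact_mod_cast (Nat.lt_mul_div_succ x hy).le.trans (le_of_eq (mul_comm _ _))

/-- An assignment that is nearly optimal for the weights of a good guess is nearly optimal for the
product of the two costs. -/
theorem product_le_of_scaled {r n α β : ℕ} {x y x' y' : ℕ → ℕ} (hr : 0 < r) (hn : 0 < n)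
    (hα : 0 < α) (hβ : 0 < β) (hx : ∀ i < r, 4 ∣ x i) (hy : ∀ i < r, 4 ∣ y i)
    (hfx : Fits (4 * n) α (∑ i ∈ Finset.range r, x' i))
    (hfy : Fits (4 * n) β (∑ i ∈ Finset.range r, y' i))
    (h : ∑ i ∈ Finset.range r, scaledWeight (12 * r * n) α β (x i) (y i) ≤
      ∑ i ∈ Finset.range r, scaledWeight (12 * r * n) α β (x' i) (y' i) + r) :
    n * ((∑ i ∈ Finset.range r, x i) * ∑ i ∈ Finset.range r, y i) ≤
      (n + 1) * ((∑ i ∈ Finset.range r, x' i) * ∑ i ∈ Finset.range r, y' i) := by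
  set A := ∑ i ∈ Finset.range r, x i with hA
  set B := ∑ i ∈ Finset.range r, y i with hB
  set A' := ∑ i ∈ Finset.range r, x' i with hA'
  set B' := ∑ i ∈ Finset.range r, y' i with hB'
  set K := 12 * r * n with hK
  have hαq : (0 : ℚ) < α := by exact_mod_cast hα
  have hβq : (0 : ℚ) < β := by exact_mod_cast hβ
  have hnq : (1 : ℚ) ≤ n := by exact_mod_cast hn
  have hrq : (1 : ℚ) ≤ r := by exact_mod_cast hr
  have hKq : (K : ℚ) = 12 * r * n := by rw [hK]; push_cast; ring
  have hfa : (A' : ℚ) / α ≤ 1 + 1 / (4 * n) := by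
    rw [div_le_iff₀ hαq]
    have : (A' : ℚ) * (4 * n) ≤ α * (4 * n + 1) := by exact_mod_cast hfx.1
    have h4 : (0 : ℚ) < 4 * n := by positivity
    calc (A' : ℚ) = A' * (4 * n) / (4 * n) := by field_simp
      _ ≤ α * (4 * n + 1) / (4 * n) := by gcongr
      _ = _ := by field_simp
  have hfb : (B' : ℚ) / β ≤ 1 + 1 / (4 * n) := by
    rw [div_le_iff₀ hβq]
    have : (B' : ℚ) * (4 * n) ≤ β * (4 * n + 1) := by exact_mod_cast hfy.1
    have h4 : (0 : ℚ) < 4 * n := by positivity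
    calc (B' : ℚ) = B' * (4 * n) / (4 * n) := by field_simp
      _ ≤ β * (4 * n + 1) / (4 * n) := by gcongr
      _ = _ := by field_simp
  -- Floors and caps only decrease weights, so the competitor's total is at most 2K(1 + 1/(4n)), and
  -- 2K/(4n) = 6r.
  have hW' : ((∑ i ∈ Finset.range r, scaledWeight K α β (x' i) (y' i) : ℕ) : ℚ) ≤
      2 * K + 6 * r := by
    calc ((∑ i ∈ Finset.range r, scaledWeight K α β (x' i) (y' i) : ℕ) : ℚ)
        ≤ ∑ i ∈ Finset.range r, (K * ((x' i : ℚ) / α) + K * ((y' i : ℚ) / β)) := by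
          push_cast
          refine Finset.sum_le_sum fun i _ => ?_
          rw [scaledWeight_eq]
          have h₁ : ((min (4 * K) (K * x' i / α + K * y' i / β) : ℕ) : ℚ) ≤
              ((K * x' i / α + K * y' i / β : ℕ) : ℚ) := by exact_mod_cast min_le_right _ _
          refine h₁.trans ?_
          push_cast
          have h₂ : ((K * x' i / α : ℕ) : ℚ) ≤ ((K * x' i : ℕ) : ℚ) / α := Nat.cast_div_le
          have h₃ : ((K * y' i / β : ℕ) : ℚ) ≤ ((K * y' i : ℕ) : ℚ) / β := Nat.cast_div_le
          push_cast at h₂ h₃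
          rw [← mul_div_assoc, ← mul_div_assoc]
          linarith
      _ = K * (A' / α) + K * (B' / β) := by
          rw [Finset.sum_add_distrib, ← Finset.mul_sum, ← Finset.mul_sum, ← Finset.sum_div,
            ← Finset.sum_div, hA', hB']
          push_cast
          rfl
      _ ≤ K * (1 + 1 / (4 * n)) + K * (1 + 1 / (4 * n)) := by gcongr
      _ = 2 * K + 6 * r := by rw [hKq]; field_simp; ring
  have hW : ((∑ i ∈ Finset.range r, scaledWeight K α β (x i) (y i) : ℕ) : ℚ) ≤ 2 * K + 7 * r := by
    have : ((∑ i ∈ Finset.range r, scaledWeight K α β (x i) (y i) : ℕ) : ℚ) ≤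
      ((∑ i ∈ Finset.range r, scaledWeight K α β (x' i) (y' i) : ℕ) : ℚ) + r := by
        exact_mod_cast h
    linarith
  have hrn : (r : ℚ) ≤ r * n := le_mul_of_one_le_right (by positivity) hnq
  -- The whole sum is at most 2K + 7r < 4K, so no entry chosen by the computed assignment reaches
  -- the cap.
  have hcap : ∀ i < r, scaledWeight K α β (x i) (y i) < 4 * K := by
    intro i hi
    have h₁ : scaledWeight K α β (x i) (y i) ≤
        ∑ i ∈ Finset.range r, scaledWeight K α β (x i) (y i) :=
      Finset.single_le_sum (f := fun i => scaledWeight K α β (x i) (y i))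
        (fun _ _ => Nat.zero_le _) (Finset.mem_range.2 hi)
    have h₂ : ((scaledWeight K α β (x i) (y i) : ℕ) : ℚ) < ((4 * K : ℕ) : ℚ) := by
      refine lt_of_le_of_lt ((Nat.cast_le.2 h₁).trans hW) ?_
      push_cast
      rw [hKq]
      nlinarith
    exact_mod_cast h₂
  -- The reason for making all costs multiples of 4: against the guess 1 a nonzero cost is at least
  -- 4 and would reach the cap. Thus a competitor of cost 0 forces cost 0, and the product vanishes.
  have hzero : ∀ (γ z : ℕ), γ = 1 → 4 ∣ z → K * z / γ < 4 * K → z = 0 := by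
    rintro γ z rfl ⟨q, rfl⟩ hlt
    rw [Nat.div_one] at hlt
    by_contra hne
    have : 1 ≤ q := by omega
    nlinarith
  have hdiv : ∀ i < r, K * x i / α + K * y i / β < 4 * K := by
    intro i hi
    have := hcap i hi
    rw [scaledWeight_eq] at this
    omega
  rcases hfx.2 with hαA | ⟨hα1, -⟩
  swap
  · have : A = 0 := Finset.sum_eq_zero fun i hi => by
      have hi := Finset.mem_range.1 hi
      exact hzero α _ hα1 (hx i hi) ((Nat.le_add_right _ _).trans_lt (hdiv i hi))
    simp [this]
  rcases hfy.2 with hβB | ⟨hβ1, -⟩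
  swap
  · have : B = 0 := Finset.sum_eq_zero fun i hi => by
      have hi := Finset.mem_range.1 hi
      exact hzero β _ hβ1 (hy i hi) ((Nat.le_add_left _ _).trans_lt (hdiv i hi))
    simp [this]
  -- Each entry consists of two floors and loses at most 2, whence 7r + 2r = 9r.
  have hlow : K * ((A : ℚ) / α) + K * ((B : ℚ) / β) ≤ 2 * K + 9 * r := by
    calc K * ((A : ℚ) / α) + K * ((B : ℚ) / β)
        = ∑ i ∈ Finset.range r, (K * ((x i : ℚ) / α) + K * ((y i : ℚ) / β)) := by
          rw [Finset.sum_add_distrib, ← Finset.mul_sum, ← Finset.mul_sum, ← Finset.sum_div,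
            ← Finset.sum_div, hA, hB]
          push_cast
          rfl
      _ ≤ ∑ i ∈ Finset.range r, ((scaledWeight K α β (x i) (y i) : ℚ) + 2) := by
          refine Finset.sum_le_sum fun i hi => ?_
          have h₁ := hdiv i (Finset.mem_range.1 hi)
          rw [scaledWeight_eq, min_eq_right h₁.le]
          have h₂ := natCast_div_le_floor_add_one (K * x i) α hα
          have h₃ := natCast_div_le_floor_add_one (K * y i) β hβ
          push_cast at h₂ h₃ ⊢
          rw [← mul_div_assoc, ← mul_div_assoc]
          linarith
      _ ≤ 2 * K + 9 * r := by
          rw [Finset.sum_add_distrib]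
          push_cast at hW
          simp only [Finset.sum_const, Finset.card_range, nsmul_eq_mul]
          linarith
  set X : ℚ := (A : ℚ) / α with hX
  set Y : ℚ := (B : ℚ) / β with hY
  have hX0 : 0 ≤ X := by positivity
  have hY0 : 0 ≤ Y := by positivity
  have hXY : 4 * n * (X + Y) ≤ 8 * n + 3 := by
    have h₁ : 3 * (r : ℚ) * (4 * n * (X + Y)) ≤ 3 * r * (8 * n + 3) := by
      rw [hKq] at hlow
      nlinarith
    exact le_of_mul_le_mul_left h₁ (by positivity)
  -- AM-GM: 64n²XY ≤ (4n(X + Y))² ≤ (8n + 3)² ≤ 64n(n + 1), the last step because 48n + 9 ≤ 64n for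
  -- n ≥ 1.
  have hprod : n * (X * Y) ≤ n + 1 := by
    have h₁ : 4 * (X * Y) ≤ (X + Y) ^ 2 := by nlinarith [sq_nonneg (X - Y)]
    have h₂ : (4 * n * (X + Y)) ^ 2 ≤ (8 * n + 3) ^ 2 := by gcongr
    have h₃ : (64 * n) * (n * (X * Y)) ≤ (64 * n) * (n + 1) := by
      have := mul_le_mul_of_nonneg_left h₁ (by positivity : (0 : ℚ) ≤ 16 * n ^ 2)
      nlinarith
    exact le_of_mul_le_mul_left h₃ (by positivity)
  have hfin : (n : ℚ) * (A * B) ≤ (n + 1) * (A' * B') := by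
    have e₁ : (A : ℚ) = X * α := by rw [hX]; field_simp
    have e₂ : (B : ℚ) = Y * β := by rw [hY]; field_simp
    have e₃ : (α : ℚ) ≤ A' := by exact_mod_cast hαA
    have e₄ : (β : ℚ) ≤ B' := by exact_mod_cast hβB
    calc (n : ℚ) * (A * B) = n * (X * Y) * (α * β) := by rw [e₁, e₂]; ring
      _ ≤ (n + 1) * (α * β) := by gcongr
      _ ≤ (n + 1) * (A' * B') := by gcongr
  exact_mod_cast hfin

/-! ## The approximation scheme as a program

Bank `0` holds the input, bank `1` the output, banks `2` and `3` the two cost matrices (the entry for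
person `j` and object `i` is in cell `j * r + i`), bank `4` the prices and bank `5` the owners. The
other banks hold scalars: `6` the common multiple, `7` the bound on the costs, `8` and `9` the guesses,
`10` the best value, `11` the number of owned objects, `12` the bidder, `13` a loop counter, `14` the
object bid for, `15` and `16` the costs of an assignment, `17` the previous owner. -/

namespace RAM

open Finset (range)

def accE : Expr := .get 0 (.lit 0)
def rE : Expr := .get 0 (.lit 1)
def sE : Expr := .get 0 (.lit 2)

@[simp] theorem eval_accE (M : Mem) : accE.eval M = M 0 0 := rfl
@[simp] theorem eval_rE (M : Mem) : rE.eval M = M 0 1 := rfl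
@[simp] theorem eval_sE (M : Mem) : sE.eval M = M 0 2 := rfl

/-- Weight plus price of object `i` for the bidder. -/
def bidE (i : Expr) : Expr :=
  (.lit 4 * (.lit 12 * rE * accE) - (.lit 4 * (.lit 12 * rE * accE) -
    (.lit 12 * rE * accE * .get 2 (var 12 * rE + i) / var 8 +
      .lit 12 * rE * accE * .get 3 (var 12 * rE + i) / var 9))) + .get 4 i

/-- The weight of object `i` for person `j`. -/
def weightAt (M : Mem) (j i : ℕ) : ℕ :=
  scaledWeight (12 * M 0 1 * M 0 0) (M 8 0) (M 9 0) (M 2 (j * M 0 1 + i)) (M 3 (j * M 0 1 + i))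

theorem weightAt_le (M : Mem) (j i : ℕ) : weightAt M j i ≤ 4 * (12 * M 0 1 * M 0 0) := by
  unfold weightAt
  rw [scaledWeight_eq]
  exact min_le_left _ _

theorem weightAt_congr {M M' : Mem} (h0 : M' 0 = M 0) (h2 : M' 2 = M 2) (h3 : M' 3 = M 3)
    (h8 : M' 8 = M 8) (h9 : M' 9 = M 9) : weightAt M' = weightAt M := by
  funext j i
  simp only [weightAt, h0, h2, h3, h8, h9]

theorem eval_bidE (M : Mem) (i : Expr) :
    (bidE i).eval M = weightAt M (M 12 0) (i.eval M) + M 4 (i.eval M) := rfl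

/-! ### The auction as a machine program -/

/-- Finds the object that is cheapest for the bidder. -/
def argmin : Cmd :=
  .seq (assign 14 (.lit 0)) <| .seq (assign 13 (.lit 1)) <|
    .loop (rE - var 13) <|
      .seq (.ite (bidE (var 14) - bidE (var 13)) (assign 14 (var 13)) .skip)
        (assign 13 (var 13 + .lit 1))

theorem argmin_runs {b : ℕ} {M : Mem} (hr : 0 < M 0 1) (hb : M 0 1 < 2 ^ b) :
    Runs b argmin M (4 * M 0 1 + 3) (fun M' => M' 14 0 < M 0 1 ∧ ∀ i < M 0 1,
      weightAt M (M 12 0) (M' 14 0) + M 4 (M' 14 0) ≤ weightAt M (M 12 0) i + M 4 i) := by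
  have h1 : 1 < 2 ^ b := by omega
  unfold argmin
  refine (Runs.assign_seq (by simp) <| Runs.assign_seq (by simpa using h1) <|
    Runs.loop_upto (T := 3) (k₀ := 1) (n := M 0 1)
      (Inv := fun k M' => M' 13 0 = k ∧ M' 14 0 < k ∧ ∀ i < k,
        weightAt M (M 12 0) (M' 14 0) + M 4 (M' 14 0) ≤ weightAt M (M 12 0) i + M 4 i)
      hr ?_ ?_ ?_).mono (by omega) fun M' h => h.2.2
  · rintro k M' hf ⟨h13, -⟩
    have h0 : M' 0 = M 0 := by simpa [Mem.write_of_ne] using hf 0 (by decide)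
    simp [h13, h0]
  · rintro k M' hf hk ⟨h13, h14, hmin⟩
    have h0 : M' 0 = M 0 := by simpa [Mem.write_of_ne] using hf 0 (by decide)
    have h2 : M' 2 = M 2 := by simpa [Mem.write_of_ne] using hf 2 (by decide)
    have h3 : M' 3 = M 3 := by simpa [Mem.write_of_ne] using hf 3 (by decide)
    have h4 : M' 4 = M 4 := by simpa [Mem.write_of_ne] using hf 4 (by decide)
    have h8 : M' 8 = M 8 := by simpa [Mem.write_of_ne] using hf 8 (by decide)
    have h9 : M' 9 = M 9 := by simpa [Mem.write_of_ne] using hf 9 (by decide)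
    have h12 : M' 12 = M 12 := by simpa [Mem.write_of_ne] using hf 12 (by decide)
    have hw := weightAt_congr h0 h2 h3 h8 h9
    have hkb : k + 1 < 2 ^ b := by omega
    refine Runs.seq (T₁ := 2) (T₂ := 1) (P := fun M'' => M'' 13 0 = k ∧ M'' 14 0 < k + 1 ∧
      ∀ i < k + 1, weightAt M (M 12 0) (M'' 14 0) + M 4 (M'' 14 0) ≤ weightAt M (M 12 0) i + M 4 i)
      (Runs.ite ?_ ?_) ?_
    · intro he
      simp only [Expr.eval_sub, eval_bidE, hw, h4, h12, eval_var, h13] at he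
      refine Runs.assign (by simp [h13]; omega) ?_
      simp only [eval_var, h13, Mem.write_apply]
      refine ⟨by simp, by simp, fun i hi => ?_⟩
      simp only [and_self, if_true]
      rcases Nat.lt_succ_iff_lt_or_eq.1 hi with hi | rfl
      · have := hmin i hi
        omega
      · exact le_rfl
    · intro he
      simp only [Expr.eval_sub, eval_bidE, hw, h4, h12, eval_var, h13] at he
      refine Runs.skip ⟨h13, by omega, fun i hi => ?_⟩
      rcases Nat.lt_succ_iff_lt_or_eq.1 hi with hi | rfl
      · exact hmin i hi
      · omega
    · rintro M'' ⟨h13, h14, hmin⟩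
      refine Runs.assign (by simpa [h13] using hkb) ?_
      exact ⟨by simp [h13], by simpa [Mem.write_apply] using h14,
        by simpa [Mem.write_apply] using hmin⟩
  · simp [Mem.write_apply]

/-- One bid. -/
def bidStep : Cmd :=
  .seq argmin <| .seq (assign 17 (.get 5 (var 14))) <| .seq (.set 5 (var 14) (var 12)) <|
    .seq (.set 4 (var 14) (.get 4 (var 14) + .lit 1)) <|
      .ite (var 17) (assign 12 (var 17))
        (.seq (assign 11 (var 11 + .lit 1)) (assign 12 (var 11 + .lit 1)))

/-- The state of the auction in memory. -/
def AuctionMem (w : ℕ → ℕ → ℕ) (k : ℕ) (M : Mem) : Prop :=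
  AuctionState (M 0 1) (4 * (12 * M 0 1 * M 0 0)) w k (M 11 0) (M 12 0) (M 5) (M 4)

theorem bidStep_runs {b k : ℕ} {M : Mem} (hr : 0 < M 0 1) (hb : M 0 1 + 3 < 2 ^ b)
    (hW : 4 * (12 * M 0 1 * M 0 0) + 3 < 2 ^ b) (h : AuctionMem (weightAt M) k M)
    (hlt : M 11 0 < M 0 1) :
    Runs b bidStep M (4 * M 0 1 + 9) (AuctionMem (weightAt M) (k + 1)) := by
  unfold bidStep
  refine (Runs.seq (argmin_runs hr (by omega)).framed ?_).mono (T₁ := 4 * M 0 1 + 3 + 6) (by omega)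
    fun _ h => h
  rintro M' ⟨⟨hi₀, hmin⟩, hf⟩
  have h0 : M' 0 = M 0 := hf 0 (by decide)
  have h4 : M' 4 = M 4 := hf 4 (by decide)
  have h5 : M' 5 = M 5 := hf 5 (by decide)
  have h11 : M' 11 = M 11 := hf 11 (by decide)
  have h12 : M' 12 = M 12 := hf 12 (by decide)
  obtain ⟨i₀, h14⟩ : ∃ i₀, M' 14 0 = i₀ := ⟨_, rfl⟩
  rw [h14] at hi₀ hmin
  have hle := h.owner_le _ hi₀
  have hcur := h.cur_le
  have hpr := h.price_le _ hi₀
  refine Runs.assign_seq (T := 5) ?_ <| Runs.set_seq (T := 4) ?_ <| Runs.set_seq (T := 3) ?_ <|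
    Runs.ite (T := 2) ?_ ?_
  · simp only [Expr.eval_get, eval_var, h5, h14]; omega
  · simp only [eval_var, Mem.write_apply, h12]
    simp only [Nat.reduceEqDiff, false_and, if_false]; omega
  · simp only [Expr.eval_get, Expr.eval_add, eval_var, Expr.eval_lit, Mem.write_apply, h4, h14]
    simp only [Nat.reduceEqDiff, false_and, if_false]; omega
  · intro he
    simp [Mem.write_apply, h5, h14] at he
    refine (Runs.assign ?_ ?_).mono (T₁ := 1) (by omega) fun _ h => h
    · simp [Mem.write_apply, h5, h14]; omega
    · have := h.bid (o' := fun i => if i = i₀ then M 12 0 else M 5 i)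
        (p' := fun i => if i = i₀ then M 4 i₀ + 1 else M 4 i) hlt (weightAt_le M) hi₀ hmin
        (fun _ _ => rfl) (fun _ _ => rfl)
      rw [if_neg he, if_neg he] at this
      unfold AuctionMem
      convert this using 1 <;> first | funext i | skip
      all_goals simp [Mem.write_apply, h0, h4, h5, h11, h12, h14]
  -- Previous owner 0 means that the object was free: one more object is now owned, and the next new
  -- person enters as bidder.
  · intro he
    simp [Mem.write_apply, h5, h14] at he
    refine Runs.assign_seq (T := 1) ?_ <| Runs.assign ?_ ?_
    · simp [Mem.write_apply, h11]; omega
    · simp [Mem.write_apply, h11]; omega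
    · have := h.bid (o' := fun i => if i = i₀ then M 12 0 else M 5 i)
        (p' := fun i => if i = i₀ then M 4 i₀ + 1 else M 4 i) hlt (weightAt_le M) hi₀ hmin
        (fun _ _ => rfl) (fun _ _ => rfl)
      rw [if_pos he, if_pos he] at this
      unfold AuctionMem
      convert this using 1 <;> first | funext i | skip
      all_goals simp [Mem.write_apply, h0, h4, h5, h11, h12, h14]

/-- Sets prices and owners to `0`. -/
def clear : Cmd :=
  .seq (assign 13 (.lit 0)) <| .loop (rE - var 13) <|
    .seq (.set 4 (var 13) (.lit 0)) <| .seq (.set 5 (var 13) (.lit 0)) <|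
      assign 13 (var 13 + .lit 1)

theorem clear_runs {b : ℕ} {M : Mem} (hb : M 0 1 < 2 ^ b) :
    Runs b clear M (4 * M 0 1 + 2) (fun M' => ∀ i < M 0 1, M' 4 i = 0 ∧ M' 5 i = 0) := by
  unfold clear
  refine (Runs.assign_seq (by simp) <| Runs.loop_upto (T := 3) (k₀ := 0) (n := M 0 1)
      (Inv := fun k M' => M' 13 0 = k ∧ ∀ i < k, M' 4 i = 0 ∧ M' 5 i = 0)
      (Nat.zero_le _) ?_ ?_ ?_).mono (by omega) fun M' h => h.2.2
  · rintro k M' hf ⟨h13, -⟩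
    have h0 : M' 0 = M 0 := by simpa [Mem.write_of_ne] using hf 0 (by decide)
    simp [h13, h0]
  · rintro k M' hf hk ⟨h13, hz⟩
    refine Runs.set_seq (T := 2) (by simp) <| Runs.set_seq (T := 1) (by simp) <| Runs.assign ?_ ?_
    · simp [Mem.write_apply, h13]; omega
    · refine ⟨by simp [Mem.write_apply, h13], fun i hi => ?_⟩
      have := hz i
      simp only [eval_var, Mem.write_apply, h13, Expr.eval_lit]
      constructor <;> simp <;> omega
  · simp

/-- The auction: assigns the objects to the persons. -/
def auction : Cmd :=
  .seq clear <| .seq (assign 11 (.lit 0)) <| .seq (assign 12 (.lit 1)) <|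
    .loop (rE - var 11) bidStep

/-- With W = 48rn at most r(W + 1) bids occur, and each needs one scan of the r objects. The costs
themselves do not enter the count, thanks to the cap. -/
theorem auction_runs {b : ℕ} {M : Mem} (hr : 0 < M 0 1) (hb : M 0 1 + 3 < 2 ^ b)
    (hW : 4 * (12 * M 0 1 * M 0 0) + 3 < 2 ^ b) :
    Runs b auction M
      (4 * M 0 1 + (M 0 1 * (4 * (12 * M 0 1 * M 0 0) + 1) + 1) * (4 * M 0 1 + 10) + 5)
      (fun M' => IsAssignment (M 0 1) (M' 5) ∧ ∀ σ, IsAssignment (M 0 1) σ →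
        ∑ i ∈ range (M 0 1), weightAt M (M' 5 i) i ≤
          ∑ i ∈ range (M 0 1), weightAt M (σ i) i + M 0 1) := by
  unfold auction
  refine (Runs.seq (clear_runs (by omega)).framed
    (T₂ := (M 0 1 * (4 * (12 * M 0 1 * M 0 0) + 1) + 1) * (4 * M 0 1 + 10) + 3)
    fun M' h => ?_).mono (by omega) fun _ h => h
  obtain ⟨hz, hf⟩ := h
  have h0 : M' 0 = M 0 := hf 0 (by decide)
  have h2 : M' 2 = M 2 := hf 2 (by decide)
  have h3 : M' 3 = M 3 := hf 3 (by decide)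
  have h8 : M' 8 = M 8 := hf 8 (by decide)
  have h9 : M' 9 = M 9 := hf 9 (by decide)
  refine (Runs.assign_seq (by simp) <| Runs.assign_seq (by simp only [Expr.eval_lit]; omega) <|
    Runs.loop (G := M 0 1 * (4 * (12 * M 0 1 * M 0 0) + 1) + 1) (T := 4 * M 0 1 + 9) (k := 0)
      (Inv := AuctionMem (weightAt M)) ?_ ?_).mono
      (le_of_eq (by rw [Nat.sub_zero]; ring)) ?_
  · intro k M'' hf' hI he
    have h0' : M'' 0 = M 0 := by simpa [Mem.write_of_ne, h0] using hf' 0 (by decide)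
    have h2' : M'' 2 = M 2 := by simpa [Mem.write_of_ne, h2] using hf' 2 (by decide)
    have h3' : M'' 3 = M 3 := by simpa [Mem.write_of_ne, h3] using hf' 3 (by decide)
    have h8' : M'' 8 = M 8 := by simpa [Mem.write_of_ne, h8] using hf' 8 (by decide)
    have h9' : M'' 9 = M 9 := by simpa [Mem.write_of_ne, h9] using hf' 9 (by decide)
    have hw := weightAt_congr h0' h2' h3' h8' h9'
    have hle := hI.bids_le
    rw [h0'] at hle
    have := bidStep_runs (b := b) (k := k) (M := M'') (by rwa [h0']) (by rwa [h0']) (by rwa [h0'])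
      (by rwa [hw]) (by simp at he; omega)
    rw [hw, h0'] at this
    exact ⟨by omega, this⟩
  · unfold AuctionMem
    refine AuctionState.init ?_ ?_ ?_ <;> simp [Mem.write_apply, h0, hr] <;> intro i hi
    · exact (hz i hi).2
    · exact (hz i hi).1
  · rintro M'' ⟨hf', k, hI, he⟩
    have h0' : M'' 0 = M 0 := by simpa [Mem.write_of_ne, h0] using hf' 0 (by decide)
    have hcnt : M'' 11 0 = M'' 0 1 := by
      have := hI.cnt_le
      simp at he
      omega
    have h₁ := hI.isAssignment hcnt
    have h₂ := fun σ => hI.sum_le hcnt (σ := σ)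
    rw [h0'] at h₁ h₂
    exact ⟨h₁, h₂⟩

/-! ### Evaluating an assignment and writing its tour -/

/-- The cost of an assignment, the costs being listed in `C`. -/
def assignCost (C : ℕ → ℕ) (r : ℕ) (o : ℕ → ℕ) : ℕ := ∑ i ∈ range r, C (o i * r + i)

/-- Computes the two costs of the assignment. -/
def evaluate : Cmd :=
  .seq (assign 13 (.lit 0)) <| .seq (assign 15 (.lit 0)) <| .seq (assign 16 (.lit 0)) <|
    .loop (rE - var 13) <|
      .seq (assign 15 (var 15 + .get 2 (.get 5 (var 13) * rE + var 13))) <|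
      .seq (assign 16 (var 16 + .get 3 (.get 5 (var 13) * rE + var 13))) <|
        assign 13 (var 13 + .lit 1)

theorem evaluate_runs {b : ℕ} {M : Mem} (hb : M 0 1 < 2 ^ b)
    (hA : assignCost (M 2) (M 0 1) (M 5) < 2 ^ b) (hB : assignCost (M 3) (M 0 1) (M 5) < 2 ^ b) :
    Runs b evaluate M (4 * M 0 1 + 4) (fun M' =>
      M' 15 0 = assignCost (M 2) (M 0 1) (M 5) ∧ M' 16 0 = assignCost (M 3) (M 0 1) (M 5)) := by
  unfold evaluate
  refine (Runs.assign_seq (by simp) <| Runs.assign_seq (by simp) <| Runs.assign_seq (by simp) <|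
    Runs.loop_upto (T := 3) (k₀ := 0) (n := M 0 1)
      (Inv := fun k M' => M' 13 0 = k ∧ M' 15 0 = ∑ i ∈ range k, M 2 (M 5 i * M 0 1 + i) ∧
        M' 16 0 = ∑ i ∈ range k, M 3 (M 5 i * M 0 1 + i))
      (Nat.zero_le _) ?_ ?_ ?_).mono (by omega) fun M' h => h.2.2
  · rintro k M' hf ⟨h13, -⟩
    have h0 : M' 0 = M 0 := by simpa [Mem.write_of_ne] using hf 0 (by decide)
    simp [h13, h0]
  · rintro k M' hf hk ⟨h13, h15, h16⟩
    have h0 : M' 0 = M 0 := by simpa [Mem.write_of_ne] using hf 0 (by decide)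
    have h2 : M' 2 = M 2 := by simpa [Mem.write_of_ne] using hf 2 (by decide)
    have h3 : M' 3 = M 3 := by simpa [Mem.write_of_ne] using hf 3 (by decide)
    have h5 : M' 5 = M 5 := by simpa [Mem.write_of_ne] using hf 5 (by decide)
    have hle : ∀ C : ℕ → ℕ, ∑ i ∈ range (k + 1), C (M 5 i * M 0 1 + i) ≤
        assignCost C (M 0 1) (M 5) := fun C =>
      Finset.sum_le_sum_of_subset (Finset.range_subset_range.2 hk)
    have hA' := hle (M 2)
    have hB' := hle (M 3)
    rw [Finset.sum_range_succ] at hA' hB'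
    refine Runs.assign_seq (T := 2) ?_ <| Runs.assign_seq (T := 1) ?_ <| Runs.assign ?_ ?_
    · simp [h13, h15, h2, h5, h0]; omega
    · simp [Mem.write_apply, h13, h16, h3, h5, h0]; omega
    · simp [Mem.write_apply, h13]; omega
    · simp [Mem.write_apply, Finset.sum_range_succ, h0, h2, h3, h5, h13, h15, h16]
  · simp [Mem.write_apply]

/-- The first vertices of the tour that inserts `v_{o i}` into the `i`-th edge if `o i ≤ s`. -/
def tourList (r s : ℕ) (o : ℕ → ℕ) (k : ℕ) : List ℕ :=
  (List.range k).flatMap fun i => (if o i ≤ s then [r + o i - 1] else []) ++ [(i + 1) % r]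

theorem tourList_succ (r s : ℕ) (o : ℕ → ℕ) (k : ℕ) : tourList r s o (k + 1) =
    tourList r s o k ++ ((if o k ≤ s then [r + o k - 1] else []) ++ [(k + 1) % r]) := by
  simp [tourList, List.range_succ]

theorem tourList_length_le (r s : ℕ) (o : ℕ → ℕ) (k : ℕ) :
    (tourList r s o k).length ≤ 2 * k := by
  induction k with
  | zero => simp [tourList]
  | succ k ih =>
    rw [tourList_succ]
    split_ifs <;> simp <;> omega

/-- Appends a word to the output. -/
def push (e : Expr) : Cmd :=
  .seq (.set 1 (var 1 + .lit 1) e) (assign 1 (var 1 + .lit 1))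

theorem length_output (M : Mem) : (output M).length = M 1 0 := by simp [output]

theorem push_runs {b : ℕ} {M : Mem} {e : Expr} (he : e.eval M < 2 ^ b) (hb : M 1 0 + 1 < 2 ^ b) :
    Runs b (push e) M 2 (fun M' => output M' = output M ++ [e.eval M]) := by
  refine Runs.set_seq (T := 1) he <| Runs.assign ?_ ?_
  · simpa [Mem.write_apply] using hb
  · simp only [output, Mem.write_self, Expr.eval_add, eval_var, Expr.eval_lit]
    simp only [Mem.write_apply, List.range_succ, List.map_append]
    simp
    intro i hi
    omega

/-- Writes the tour that belongs to the assignment to the output. -/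
def writeTour : Cmd :=
  .seq (assign 1 (.lit 0)) <| .seq (assign 13 (.lit 0)) <|
    .loop (rE - var 13) <|
      .seq (.ite (sE + .lit 1 - .get 5 (var 13)) (push (rE + .get 5 (var 13) - .lit 1)) .skip) <|
      .seq (push (var 13 + .lit 1 - rE * ((var 13 + .lit 1) / rE))) <|
        assign 13 (var 13 + .lit 1)

theorem writeTour_runs {b : ℕ} {M : Mem} (hb : 2 * M 0 1 + 2 < 2 ^ b)
    (ho : ∀ i < M 0 1, M 5 i ≤ M 0 1) :
    Runs b writeTour M (7 * M 0 1 + 3) (fun M' =>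
      output M' = tourList (M 0 1) (M 0 2) (M 5) (M 0 1)) := by
  unfold writeTour
  refine (Runs.assign_seq (by simp) <| Runs.assign_seq (by simp) <|
    Runs.loop_upto (T := 6) (k₀ := 0) (n := M 0 1)
      (Inv := fun k M' => M' 13 0 = k ∧ output M' = tourList (M 0 1) (M 0 2) (M 5) k)
      (Nat.zero_le _) ?_ ?_ ?_).mono (by omega) fun M' h => h.2.2
  · rintro k M' hf ⟨h13, -⟩
    have h0 : M' 0 = M 0 := by simpa [Mem.write_of_ne] using hf 0 (by decide)
    simp [h13, h0]
  · rintro k M' hf hk ⟨h13, hout⟩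
    have h0 : M' 0 = M 0 := by simpa [Mem.write_of_ne] using hf 0 (by decide)
    have h5 : M' 5 = M 5 := by simpa [Mem.write_of_ne] using hf 5 (by decide)
    have hlen := tourList_length_le (M 0 1) (M 0 2) (M 5) k
    have hok := ho k hk
    rw [← hout, length_output] at hlen
    refine Runs.seq (T₁ := 3) (T₂ := 3) (P := fun M'' => (∀ x, x ≠ 1 → M'' x = M' x) ∧
      output M'' = tourList (M 0 1) (M 0 2) (M 5) k ++
        if M 5 k ≤ M 0 2 then [M 0 1 + M 5 k - 1] else []) (Runs.ite ?_ ?_) ?_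
    · intro he
      simp [h0, h5, h13] at he
      refine (push_runs ?_ (by omega)).framed.mono le_rfl ?_
      · simp [h0, h5, h13]; omega
      · rintro M'' ⟨h, hf'⟩
        refine ⟨fun x hx => hf' x (by simpa [push, assign, Cmd.writes] using hx), ?_⟩
        rw [h, hout, if_pos (by omega)]
        simp [h0, h5, h13]
    · intro he
      simp [h0, h5, h13] at he
      refine (Runs.skip ?_).mono (T₁ := 1) (by omega) fun _ h => h
      refine ⟨fun _ _ => rfl, ?_⟩
      rw [if_neg (by omega), hout, List.append_nil]
    · rintro M'' ⟨hf', hout'⟩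
      -- The program has to express the remainder by division and subtraction.
      have hmod : k + 1 - M 0 1 * ((k + 1) / M 0 1) = (k + 1) % M 0 1 := by
        have := Nat.mod_add_div (k + 1) (M 0 1)
        omega
      have hlen' : M'' 1 0 ≤ 2 * k + 1 := by
        rw [← length_output M'', hout']
        rw [← length_output M', hout] at hlen
        split_ifs <;> simp <;> omega
      refine Runs.seq (T₁ := 2) (T₂ := 1) (push_runs ?_ (by omega)).framed ?_
      · simp only [Expr.eval_sub, Expr.eval_add, eval_var, Expr.eval_lit, Expr.eval_mul,
          Expr.eval_div, eval_rE, hf' 13 (by decide), hf' 0 (by decide), h13, h0]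
        omega
      · rintro N ⟨hN, hfN⟩
        have h13' : N 13 0 = k := by
          rw [hfN 13 (by decide), hf' 13 (by decide), h13]
        refine Runs.assign ?_ ⟨?_, ?_⟩
        · simp [h13']; omega
        · simp [h13']
        · have : output (N.write 13 0 (Expr.eval N (var 13 + Expr.lit 1))) = output N := by
            simp [output, Mem.write_apply]
          rw [this, hN, hout', tourList_succ]
          simp [hf' 13 (by decide), hf' 0 (by decide), h13, h0, hmod]
  · simp [Mem.write_apply, output, tourList]

/-! ### Search over pairs of guesses -/

/-- The matrices are filled with multiples of `4`, and `S` bounds the costs of assignments. -/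
structure CostsReady (S : ℕ) (M : Mem) : Prop where
  r_pos : 0 < M 0 1
  acc_pos : 0 < M 0 0
  four_dvd : ∀ j i, 1 ≤ j → j ≤ M 0 1 → i < M 0 1 →
    4 ∣ M 2 (j * M 0 1 + i) ∧ 4 ∣ M 3 (j * M 0 1 + i)
  cost_le : ∀ o, IsAssignment (M 0 1) o →
    assignCost (M 2) (M 0 1) o ≤ S ∧ assignCost (M 3) (M 0 1) o ≤ S

theorem CostsReady.congr {S : ℕ} {M M' : Mem} (h : CostsReady S M) (h0 : M' 0 = M 0)
    (h2 : M' 2 = M 2) (h3 : M' 3 = M 3) : CostsReady S M' := by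
  obtain ⟨h₁, h₂, h₃, h₄⟩ := h
  rw [← h0, ← h2, ← h3] at *
  exact ⟨h₁, h₂, h₃, h₄⟩

/-- A value that has been improved at least once is that of the tour in the output. -/
def BestFound (S : ℕ) (M : Mem) : Prop :=
  M 10 0 ≤ 2 * (S * S) → ∃ o, IsAssignment (M 0 1) o ∧
    assignCost (M 2) (M 0 1) o * assignCost (M 3) (M 0 1) o = M 10 0 ∧
      output M = tourList (M 0 1) (M 0 2) o (M 0 1)

theorem BestFound.congr {S : ℕ} {M M' : Mem} (h : BestFound S M) (h0 : M' 0 = M 0)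
    (h1 : M' 1 = M 1) (h2 : M' 2 = M 2) (h3 : M' 3 = M 3) (h10 : M' 10 = M 10) :
    BestFound S M' := by
  unfold BestFound output at *
  rw [h0, h1, h2, h3, h10]
  exact h

/-- `v` is nearly as good as the assignments for which `α` and `β` are good guesses. -/
def Covered (M : Mem) (v α β : ℕ) : Prop :=
  ∀ σ, IsAssignment (M 0 1) σ → Fits (4 * M 0 0) α (assignCost (M 2) (M 0 1) σ) →
    Fits (4 * M 0 0) β (assignCost (M 3) (M 0 1) σ) →
      M 0 0 * v ≤ (M 0 0 + 1) * (assignCost (M 2) (M 0 1) σ * assignCost (M 3) (M 0 1) σ)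

theorem Covered.mono {M : Mem} {v v' α β : ℕ} (h : Covered M v α β) (hv : v' ≤ v) :
    Covered M v' α β := fun σ h₁ h₂ h₃ => (Nat.mul_le_mul_left _ hv).trans (h σ h₁ h₂ h₃)

theorem covered_congr {M M' : Mem} (h0 : M' 0 = M 0) (h2 : M' 2 = M 2) (h3 : M' 3 = M 3) :
    Covered M' = Covered M := by
  unfold Covered
  rw [h0, h2, h3]

/-- Tries one pair of guesses. -/
def tryGuess : Cmd :=
  .seq auction <| .seq evaluate <|
    .ite (var 10 - var 15 * var 16) (.seq (assign 10 (var 15 * var 16)) writeTour) .skip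

/-- A bound on the number of steps of `tryGuess`. -/
def guessSteps (r n : ℕ) : ℕ :=
  4 * r + (r * (4 * (12 * r * n) + 1) + 1) * (4 * r + 10) + 5 + (4 * r + 4 + (7 * r + 5))

/-- The auction's assignment is nearly as good as every assignment fitting the current guesses, by
`product_le_of_scaled`. The stored best value becomes the minimum of itself and the new product, so
it inherits this, and the output is rewritten exactly when the value improves. -/
theorem tryGuess_runs {b S : ℕ} {M : Mem} (hM : CostsReady S M) (hα : 0 < M 8 0)
    (hβ : 0 < M 9 0) (hb : 2 * M 0 1 + 3 < 2 ^ b) (hW : 4 * (12 * M 0 1 * M 0 0) + 3 < 2 ^ b)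
    (hS : S < 2 ^ b) (hSS : S * S < 2 ^ b) (hbest : BestFound S M) :
    Runs b tryGuess M (guessSteps (M 0 1) (M 0 0)) (fun M' => BestFound S M' ∧
      M' 10 0 ≤ M 10 0 ∧ Covered M (M' 10 0) (M 8 0) (M 9 0)) := by
  unfold tryGuess guessSteps
  refine Runs.seq (auction_runs hM.r_pos (by omega) hW).framed ?_
  rintro M₁ ⟨⟨ho, hopt⟩, hf₁⟩
  have h0 : M₁ 0 = M 0 := hf₁ 0 (by decide)
  have h1 : M₁ 1 = M 1 := hf₁ 1 (by decide)
  have h2 : M₁ 2 = M 2 := hf₁ 2 (by decide)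
  have h3 : M₁ 3 = M 3 := hf₁ 3 (by decide)
  have h10 : M₁ 10 = M 10 := hf₁ 10 (by decide)
  obtain ⟨hA, hB⟩ := hM.cost_le _ ho
  have hcov : Covered M (assignCost (M 2) (M 0 1) (M₁ 5) * assignCost (M 3) (M 0 1) (M₁ 5))
      (M 8 0) (M 9 0) := by
    intro σ hσ hfa hfb
    refine product_le_of_scaled hM.r_pos hM.acc_pos hα hβ ?_ ?_ hfa hfb (hopt σ hσ)
    · exact fun i hi => (hM.four_dvd _ _ (ho.1 i hi).1 (ho.1 i hi).2 hi).1
    · exact fun i hi => (hM.four_dvd _ _ (ho.1 i hi).1 (ho.1 i hi).2 hi).2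
  have hev := (evaluate_runs (b := b) (M := M₁) (by rw [h0]; omega) (by rw [h0, h2]; omega)
    (by rw [h0, h3]; omega)).framed
  rw [h0, h2, h3] at hev
  refine Runs.seq hev ?_
  rintro M₂ ⟨⟨h15, h16⟩, hf₂⟩
  have h0' : M₂ 0 = M 0 := (hf₂ 0 (by decide)).trans h0
  have h1' : M₂ 1 = M 1 := (hf₂ 1 (by decide)).trans h1
  have h2' : M₂ 2 = M 2 := (hf₂ 2 (by decide)).trans h2
  have h3' : M₂ 3 = M 3 := (hf₂ 3 (by decide)).trans h3
  have h5' : M₂ 5 = M₁ 5 := hf₂ 5 (by decide)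
  have h10' : M₂ 10 = M 10 := (hf₂ 10 (by decide)).trans h10
  have hAB : assignCost (M 2) (M 0 1) (M₁ 5) * assignCost (M 3) (M 0 1) (M₁ 5) ≤ S * S :=
    Nat.mul_le_mul hA hB
  refine Runs.ite (T := 7 * M 0 1 + 4) ?_ ?_
  · intro he
    simp only [Expr.eval_sub, Expr.eval_mul, eval_var, h15, h16, h10'] at he
    refine (Runs.assign_seq (T := 7 * M 0 1 + 3) ?_ ?_).mono (by omega) fun _ h => h
    · simp only [Expr.eval_mul, eval_var, h15, h16]; omega
    · have hwt := (writeTour_runs (b := b) (M := M₂.write 10 0 ((var 15 * var 16).eval M₂))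
        (by simp [Mem.write_apply, h0']; omega)
        (by simpa [Mem.write_apply, h0', h5'] using fun i hi => (ho.1 i hi).2)).framed
      simp only [Mem.write_of_ne _ _ _ (by decide : (0 : ℕ) ≠ 10), h0',
        Mem.write_of_ne _ _ _ (by decide : (5 : ℕ) ≠ 10), h5'] at hwt
      refine hwt.mono le_rfl ?_
      rintro M₃ ⟨hout, hf₃⟩
      have e0 : M₃ 0 = M 0 := by
        rw [hf₃ 0 (by decide), Mem.write_of_ne _ _ _ (by decide), h0']
      have e2 : M₃ 2 = M 2 := by
        rw [hf₃ 2 (by decide), Mem.write_of_ne _ _ _ (by decide), h2']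
      have e3 : M₃ 3 = M 3 := by
        rw [hf₃ 3 (by decide), Mem.write_of_ne _ _ _ (by decide), h3']
      have e10 : M₃ 10 0 =
          assignCost (M 2) (M 0 1) (M₁ 5) * assignCost (M 3) (M 0 1) (M₁ 5) := by
        rw [hf₃ 10 (by decide), Mem.write_self, Expr.eval_mul, eval_var, eval_var, h15, h16]
      refine ⟨fun _ => ⟨M₁ 5, ?_, ?_, ?_⟩, ?_, ?_⟩
      · rwa [e0]
      · rw [e0, e2, e3, e10]
      · rw [e0]; exact hout
      · omega
      · rw [e10]; exact hcov
  · intro he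
    simp only [Expr.eval_sub, Expr.eval_mul, eval_var, h15, h16, h10'] at he
    refine (Runs.skip ⟨?_, ?_, ?_⟩).mono (T₁ := 1) (by omega) fun _ h => h
    · exact hbest.congr h0' h1' h2' h3' h10'
    · rw [h10']
    · rw [h10']; exact hcov.mono (by omega)

/-- The next guess after the one in bank `x`. -/
def nextGuess (x : ℕ) : Cmd := assign x (var x + var x / (.lit 4 * accE) + .lit 1)

/-- Tries all second guesses. -/
def searchSecond : Cmd :=
  .seq (assign 9 (.lit 1)) <| .loop (var 7 + .lit 1 - var 9) <| .seq tryGuess (nextGuess 9)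

/-- Tries all pairs of guesses. -/
def search : Cmd :=
  .seq (assign 8 (.lit 1)) <| .loop (var 7 + .lit 1 - var 8) <| .seq searchSecond (nextGuess 8)

theorem searchSecond_runs {b S L : ℕ} {M : Mem} (hM : CostsReady S M) (hα : 0 < M 8 0)
    (h7 : M 7 0 = S) (hL : S < 2 ^ L)
    (hb : 2 * M 0 1 + 3 < 2 ^ b) (hW : 4 * (12 * M 0 1 * M 0 0) + 3 < 2 ^ b)
    (hS : 2 * S + 1 < 2 ^ b) (hSS : S * S < 2 ^ b) (hbest : BestFound S M) :
    Runs b searchSecond M (4 * M 0 0 * L * (guessSteps (M 0 1) (M 0 0) + 2) + 2)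
      (fun M' => BestFound S M' ∧ M' 10 0 ≤ M 10 0 ∧ ∀ l, grid (4 * M 0 0) l ≤ S →
        Covered M (M' 10 0) (M 8 0) (grid (4 * M 0 0) l)) := by
  have hn := hM.acc_pos
  unfold searchSecond
  refine (Runs.assign_seq (by simp only [Expr.eval_lit]; omega) <|
    Runs.loop (G := 4 * M 0 0 * L) (T := guessSteps (M 0 1) (M 0 0) + 1) (k := 0)
      (Inv := fun k M' => M' 9 0 = grid (4 * M 0 0) k ∧ BestFound S M' ∧ M' 10 0 ≤ M 10 0 ∧
        ∀ l < k, Covered M (M' 10 0) (M 8 0) (grid (4 * M 0 0) l)) ?_ ?_).mono ?_ ?_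
  · rintro k M' hf ⟨h9, hB, hle, hcov⟩ he
    have e0 : M' 0 = M 0 := by simpa [Mem.write_of_ne] using hf 0 (by decide)
    have e2 : M' 2 = M 2 := by simpa [Mem.write_of_ne] using hf 2 (by decide)
    have e3 : M' 3 = M 3 := by simpa [Mem.write_of_ne] using hf 3 (by decide)
    have e7 : M' 7 = M 7 := by simpa [Mem.write_of_ne] using hf 7 (by decide)
    have e8 : M' 8 = M 8 := by simpa [Mem.write_of_ne] using hf 8 (by decide)
    have hgS : grid (4 * M 0 0) k ≤ S := by
      simp only [Expr.eval_sub, Expr.eval_add, eval_var, Expr.eval_lit, e7, h7, h9] at he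
      omega
    constructor
    -- The guard lets the guess be at most S < 2 ^ L, while the grid has reached 2 ^ L after 4nL
    -- steps.
    · by_contra! hge
      have h₁ := two_pow_le_grid (N := 4 * M 0 0) (by omega) L
      have h₂ := grid_mono (4 * M 0 0) hge
      omega
    have htry := (tryGuess_runs (b := b) (hM.congr e0 e2 e3) (by rwa [e8])
      (by rw [h9]; exact one_le_grid _ _) (by rwa [e0]) (by rwa [e0]) (by omega) hSS hB).framed
    rw [e0, covered_congr e0 e2 e3, e8, h9] at htry
    refine Runs.seq htry ?_
    rintro M₂ ⟨⟨hB₂, hle₂, hcov₂⟩, hf₂⟩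
    have h9₂ : M₂ 9 0 = grid (4 * M 0 0) k := by rw [hf₂ 9 (by decide), h9]
    have h0₂ : M₂ 0 = M 0 := by rw [hf₂ 0 (by decide), e0]
    have hnext : (var 9 + var 9 / (.lit 4 * accE) + .lit 1 : Expr).eval M₂ =
        grid (4 * M 0 0) (k + 1) := by
      simp [h9₂, h0₂, grid]
    refine Runs.assign ?_ ?_
    · rw [hnext]
      have := Nat.div_le_self (grid (4 * M 0 0) k) (4 * M 0 0)
      simp only [grid]
      omega
    · rw [hnext]
      refine ⟨by simp, ?_, ?_, ?_⟩
      · refine hB₂.congr ?_ ?_ ?_ ?_ ?_ <;> exact Mem.write_of_ne _ _ _ (by decide)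
      · rw [Mem.write_of_ne _ _ _ (by decide)]
        exact hle₂.trans hle
      · intro l hl
        rw [Mem.write_of_ne _ _ _ (by decide)]
        rcases Nat.lt_succ_iff_lt_or_eq.1 hl with hl | rfl
        · exact (hcov l hl).mono hle₂
        · exact hcov₂
  · refine ⟨by simp [grid], ?_, ?_, by simp⟩
    · refine hbest.congr ?_ ?_ ?_ ?_ ?_ <;> exact Mem.write_of_ne _ _ _ (by decide)
    · rw [Mem.write_of_ne _ _ _ (by decide)]
  · exact le_of_eq (by rw [Nat.sub_zero]; ring)
  · rintro M' ⟨hf, k, ⟨h9, hB, hle, hcov⟩, he⟩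
    refine ⟨hB, hle, fun l hl => hcov l ?_⟩
    have e7 : M' 7 = M 7 := by simpa [Mem.write_of_ne] using hf 7 (by decide)
    simp only [Expr.eval_sub, Expr.eval_add, eval_var, Expr.eval_lit, e7, h7, h9] at he
    by_contra! hge
    have := grid_mono (4 * M 0 0) hge
    omega

theorem search_runs {b S L : ℕ} {M : Mem} (hM : CostsReady S M)
    (h7 : M 7 0 = S) (hS1 : 1 ≤ S) (hL : S < 2 ^ L)
    (hb : 2 * M 0 1 + 3 < 2 ^ b) (hW : 4 * (12 * M 0 1 * M 0 0) + 3 < 2 ^ b)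
    (hS : 2 * S + 1 < 2 ^ b) (hSS : S * S < 2 ^ b) (hbest : BestFound S M) :
    Runs b search M
      (4 * M 0 0 * L * (4 * M 0 0 * L * (guessSteps (M 0 1) (M 0 0) + 2) + 4) + 2)
      (fun M' => BestFound S M' ∧ ∀ σ, IsAssignment (M 0 1) σ → M 0 0 * M' 10 0 ≤
        (M 0 0 + 1) * (assignCost (M 2) (M 0 1) σ * assignCost (M 3) (M 0 1) σ)) := by
  have hn := hM.acc_pos
  unfold search
  refine (Runs.assign_seq (by simp only [Expr.eval_lit]; omega) <|
    Runs.loop (G := 4 * M 0 0 * L)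
      (T := 4 * M 0 0 * L * (guessSteps (M 0 1) (M 0 0) + 2) + 2 + 1) (k := 0)
      (Inv := fun k M' => M' 8 0 = grid (4 * M 0 0) k ∧ BestFound S M' ∧
        ∀ l < k, ∀ m, grid (4 * M 0 0) m ≤ S →
          Covered M (M' 10 0) (grid (4 * M 0 0) l) (grid (4 * M 0 0) m)) ?_ ?_).mono ?_ ?_
  · rintro k M' hf ⟨h8, hB, hcov⟩ he
    have e0 : M' 0 = M 0 := by simpa [Mem.write_of_ne] using hf 0 (by decide)
    have e2 : M' 2 = M 2 := by simpa [Mem.write_of_ne] using hf 2 (by decide)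
    have e3 : M' 3 = M 3 := by simpa [Mem.write_of_ne] using hf 3 (by decide)
    have e7 : M' 7 = M 7 := by simpa [Mem.write_of_ne] using hf 7 (by decide)
    have hgS : grid (4 * M 0 0) k ≤ S := by
      simp only [Expr.eval_sub, Expr.eval_add, eval_var, Expr.eval_lit, e7, h7, h8] at he
      omega
    constructor
    · by_contra! hge
      have h₁ := two_pow_le_grid (N := 4 * M 0 0) (by omega) L
      have h₂ := grid_mono (4 * M 0 0) hge
      omega
    have hsec := (searchSecond_runs (b := b) (hM.congr e0 e2 e3)
      (by rw [h8]; exact one_le_grid _ _) (by rw [e7, h7]) hL (by rwa [e0]) (by rwa [e0]) hS hSS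
      hB).framed
    rw [e0, covered_congr e0 e2 e3, h8] at hsec
    refine Runs.seq hsec ?_
    rintro M₂ ⟨⟨hB₂, hle₂, hcov₂⟩, hf₂⟩
    have h8₂ : M₂ 8 0 = grid (4 * M 0 0) k := by rw [hf₂ 8 (by decide), h8]
    have h0₂ : M₂ 0 = M 0 := by rw [hf₂ 0 (by decide), e0]
    have hnext : (var 8 + var 8 / (.lit 4 * accE) + .lit 1 : Expr).eval M₂ =
        grid (4 * M 0 0) (k + 1) := by
      simp [h8₂, h0₂, grid]
    refine Runs.assign ?_ ?_
    · rw [hnext]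
      have := Nat.div_le_self (grid (4 * M 0 0) k) (4 * M 0 0)
      simp only [grid]
      omega
    · rw [hnext]
      refine ⟨by simp, ?_, ?_⟩
      · refine hB₂.congr ?_ ?_ ?_ ?_ ?_ <;> exact Mem.write_of_ne _ _ _ (by decide)
      · intro l hl m hm
        rw [Mem.write_of_ne _ _ _ (by decide)]
        rcases Nat.lt_succ_iff_lt_or_eq.1 hl with hl | rfl
        · exact (hcov l hl m hm).mono hle₂
        · exact hcov₂ m hm
  · refine ⟨by simp [grid], ?_, by simp⟩
    refine hbest.congr ?_ ?_ ?_ ?_ ?_ <;> exact Mem.write_of_ne _ _ _ (by decide)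
  · exact le_of_eq (by rw [Nat.sub_zero]; ring)
  · rintro M' ⟨hf, k, ⟨h8, hB, hcov⟩, he⟩
    refine ⟨hB, fun σ hσ => ?_⟩
    have e7 : M' 7 = M 7 := by simpa [Mem.write_of_ne] using hf 7 (by decide)
    simp only [Expr.eval_sub, Expr.eval_add, eval_var, Expr.eval_lit, e7, h7, h8] at he
    obtain ⟨hA, hB'⟩ := hM.cost_le σ hσ
    -- Both costs of any competitor lie below S, so each has a fitting grid point that the search
    -- has visited.
    obtain ⟨l, hl, hfl⟩ := exists_fits (N := 4 * M 0 0) hA hS1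
    obtain ⟨m, hm, hfm⟩ := exists_fits (N := 4 * M 0 0) hB' hS1
    refine hcov l ?_ m hm σ hσ hfl hfm
    by_contra! hge
    have := grid_mono (4 * M 0 0) hge
    omega

end RAM

/-! ## Reading the input -/

namespace RAM

open Finset (range)

/-- The contribution of the `m`-th edge to the common multiple of the denominators. -/
def blockProd (w : ℕ → ℕ) (m : ℕ) : ℕ :=
  (w (3 + 4 * m) + 1) * w (4 + 4 * m) * ((w (5 + 4 * m) + 1) * w (6 + 4 * m))

/-- A multiple of the denominators of the first `k` edges that also exceeds the numerators. -/
def commonMultiple (w : ℕ → ℕ) (k : ℕ) : ℕ := ∏ m ∈ range k, blockProd w m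

/-- The integral cost of the `m`-th edge: `c = 0` for the first cost and `c = 2` for the second. -/
def scaledCost (w : ℕ → ℕ) (D c m : ℕ) : ℕ := 4 * w (3 + c + 4 * m) * (D / w (4 + c + 4 * m))

/-- The cost of assigning object `i` to person `j`: inserting `v_j` into the `i`-th edge if `j ≤ s`,
keeping that edge otherwise. -/
def entry (w : ℕ → ℕ) (D c j i : ℕ) : ℕ :=
  if j ≤ w 2 then scaledCost w D c (w 1 + i * w 2 + (j - 1)) +
    scaledCost w D c (w 1 + (i + 1) % w 1 * w 2 + (j - 1))
  else scaledCost w D c i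

/-- All denominators are positive. -/
def DenPos (w : ℕ → ℕ) (k : ℕ) : Prop := ∀ m < k, 0 < w (4 + 4 * m) ∧ 0 < w (6 + 4 * m)

theorem commonMultiple_pos {w : ℕ → ℕ} {k : ℕ} (hw : DenPos w k) : 0 < commonMultiple w k := by
  refine Finset.prod_pos fun m hm => ?_
  obtain ⟨h₁, h₂⟩ := hw m (Finset.mem_range.1 hm)
  unfold blockProd
  positivity

theorem commonMultiple_mono {w : ℕ → ℕ} {k l : ℕ} (hw : DenPos w l) (h : k ≤ l) :
    commonMultiple w k ≤ commonMultiple w l :=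
  Nat.le_of_dvd (commonMultiple_pos hw)
    (Finset.prod_dvd_prod_of_subset _ _ _ (Finset.range_subset_range.2 h))

theorem blockProd_dvd {w : ℕ → ℕ} {k m : ℕ} (hm : m < k) : blockProd w m ∣ commonMultiple w k :=
  Finset.dvd_prod_of_mem _ (Finset.mem_range.2 hm)

theorem den_dvd {w : ℕ → ℕ} {k m c : ℕ} (hm : m < k) (hc : c = 0 ∨ c = 2) :
    w (4 + c + 4 * m) ∣ commonMultiple w k := by
  refine Dvd.dvd.trans ?_ (blockProd_dvd hm)
  rcases hc with rfl | rfl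
  · exact Dvd.intro_left _ rfl |>.mul_right _
  · exact Dvd.intro_left _ rfl |>.mul_left _

/-- The factors numerator + 1 serve only this bound. Since D dominates the numerators, a bound S on
all costs is computable from D and r without scanning for a maximum. -/
theorem num_le {w : ℕ → ℕ} {k m c : ℕ} (hw : DenPos w k) (hm : m < k) (hc : c = 0 ∨ c = 2) :
    w (3 + c + 4 * m) ≤ commonMultiple w k := by
  have hdvd : w (3 + c + 4 * m) + 1 ∣ commonMultiple w k := by
    refine Dvd.dvd.trans ?_ (blockProd_dvd hm)
    rcases hc with rfl | rfl
    · exact (Dvd.intro _ rfl).mul_right _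
    · exact (Dvd.intro _ rfl).mul_left _
  have := Nat.le_of_dvd (commonMultiple_pos hw) hdvd
  omega

theorem scaledCost_le {w : ℕ → ℕ} {k m c : ℕ} (hw : DenPos w k) (hm : m < k)
    (hc : c = 0 ∨ c = 2) : scaledCost w (commonMultiple w k) c m ≤
      4 * (commonMultiple w k * commonMultiple w k) := by
  unfold scaledCost
  rw [mul_assoc]
  exact Nat.mul_le_mul_left _ (Nat.mul_le_mul (num_le hw hm hc) (Nat.div_le_self _ _))

theorem four_dvd_scaledCost (w : ℕ → ℕ) (D c m : ℕ) : 4 ∣ scaledCost w D c m :=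
  ⟨w (3 + c + 4 * m) * (D / w (4 + c + 4 * m)), mul_assoc _ _ _⟩

theorem four_dvd_entry (w : ℕ → ℕ) (D c j i : ℕ) : 4 ∣ entry w D c j i := by
  unfold entry
  split_ifs
  · exact dvd_add (four_dvd_scaledCost _ _ _ _) (four_dvd_scaledCost _ _ _ _)
  · exact four_dvd_scaledCost _ _ _ _

theorem crossIndex_lt {r s i j : ℕ} (hi : i < r) (hj : 1 ≤ j) (hjs : j ≤ s) :
    r + i * s + (j - 1) < r + r * s := by
  have : (i + 1) * s ≤ r * s := Nat.mul_le_mul_right _ hi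
  rw [add_mul, one_mul] at this
  omega

theorem entry_le {w : ℕ → ℕ} {c i j : ℕ} (hw : DenPos w (w 1 + w 1 * w 2))
    (hc : c = 0 ∨ c = 2) (hi : i < w 1) (hj : 1 ≤ j) :
    entry w (commonMultiple w (w 1 + w 1 * w 2)) c j i ≤
      8 * (commonMultiple w (w 1 + w 1 * w 2) * commonMultiple w (w 1 + w 1 * w 2)) := by
  unfold entry
  split_ifs with hjs
  · have h₁ := scaledCost_le hw (crossIndex_lt hi hj hjs) hc
    have h₂ := scaledCost_le hw (crossIndex_lt (Nat.mod_lt (i + 1) (by omega)) hj hjs) hc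
    omega
  · have h₁ := scaledCost_le hw (m := i) (by omega) hc
    omega

/-! ### Computing the common multiple and the cost matrices -/

/-- Computes the common multiple. -/
def multiply : Cmd :=
  .seq (assign 6 (.lit 1)) <| .seq (assign 13 (.lit 0)) <|
    .loop (rE + rE * sE - var 13) <|
      .seq (assign 6 (var 6 *
        ((.get 0 (.lit 3 + .lit 4 * var 13) + .lit 1) * .get 0 (.lit 4 + .lit 4 * var 13) *
          ((.get 0 (.lit 5 + .lit 4 * var 13) + .lit 1) * .get 0 (.lit 6 + .lit 4 * var 13))))) <|
        assign 13 (var 13 + .lit 1)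

theorem multiply_runs {b : ℕ} {M : Mem} (hw : DenPos (M 0) (M 0 1 + M 0 1 * M 0 2))
    (hb : M 0 1 + M 0 1 * M 0 2 + 1 < 2 ^ b)
    (hD : commonMultiple (M 0) (M 0 1 + M 0 1 * M 0 2) < 2 ^ b) :
    Runs b multiply M (3 * (M 0 1 + M 0 1 * M 0 2) + 3)
      (fun M' => M' 6 0 = commonMultiple (M 0) (M 0 1 + M 0 1 * M 0 2)) := by
  unfold multiply
  refine (Runs.assign_seq (by simp only [Expr.eval_lit]; omega) <| Runs.assign_seq (by simp) <|
    Runs.loop_upto (T := 2) (k₀ := 0) (n := M 0 1 + M 0 1 * M 0 2)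
      (Inv := fun k M' => M' 13 0 = k ∧ M' 6 0 = commonMultiple (M 0) k)
      (Nat.zero_le _) ?_ ?_ ?_).mono (by omega) fun M' h => h.2.2
  · rintro k M' hf ⟨h13, -⟩
    have h0 : M' 0 = M 0 := by simpa [Mem.write_of_ne] using hf 0 (by decide)
    simp [h13, h0]
  · rintro k M' hf hk ⟨h13, h6⟩
    have h0 : M' 0 = M 0 := by simpa [Mem.write_of_ne] using hf 0 (by decide)
    have hle := commonMultiple_mono hw (show k + 1 ≤ _ from hk)
    have hsucc : commonMultiple (M 0) (k + 1) = commonMultiple (M 0) k * blockProd (M 0) k :=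
      Finset.prod_range_succ _ _
    have hev : (var 6 *
        ((.get 0 (.lit 3 + .lit 4 * var 13) + .lit 1) * .get 0 (.lit 4 + .lit 4 * var 13) *
          ((.get 0 (.lit 5 + .lit 4 * var 13) + .lit 1) *
            .get 0 (.lit 6 + .lit 4 * var 13))) : Expr).eval M' =
        commonMultiple (M 0) (k + 1) := by
      simp [hsucc, blockProd, h13, h6, h0]
    refine Runs.assign_seq (T := 1) (by rw [hev]; omega) <| Runs.assign ?_ ?_
    · simp [Mem.write_apply, h13]; omega
    · rw [hev]
      simp [Mem.write_apply, h13]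
  · simp [Mem.write_apply, commonMultiple]

def scaledCostE (c : ℕ) (m : Expr) : Expr :=
  .lit 4 * .get 0 (.lit (3 + c) + .lit 4 * m) * (var 6 / .get 0 (.lit (4 + c) + .lit 4 * m))

theorem eval_scaledCostE (M : Mem) (c : ℕ) (m : Expr) :
    (scaledCostE c m).eval M = scaledCost (M 0) (M 6 0) c (m.eval M) := rfl

/-- The column of the current matrix entry. -/
def colE : Expr := var 13 - rE * (var 13 / rE)

/-- The column after that of the current matrix entry, cyclically. -/
def nextColE : Expr := colE + .lit 1 - rE * ((colE + .lit 1) / rE)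

theorem sub_mul_div_eq_mod (k r : ℕ) : k - r * (k / r) = k % r := by
  have := Nat.mod_add_div k r
  omega

theorem eval_colE (M : Mem) : colE.eval M = M 13 0 % M 0 1 := sub_mul_div_eq_mod _ _

theorem eval_nextColE (M : Mem) : nextColE.eval M = (M 13 0 % M 0 1 + 1) % M 0 1 := by
  rw [← eval_colE]
  exact sub_mul_div_eq_mod _ _

def insertE (c : ℕ) : Expr :=
  scaledCostE c (rE + colE * sE + (var 13 / rE - .lit 1)) +
    scaledCostE c (rE + nextColE * sE + (var 13 / rE - .lit 1))

/-- Fills the two cost matrices. -/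
def fill : Cmd :=
  .seq (assign 13 rE) <| .loop (rE * rE + rE - var 13) <|
    .seq (.ite (sE + .lit 1 - var 13 / rE)
      (.seq (.set 2 (var 13) (insertE 0)) (.set 3 (var 13) (insertE 2)))
      (.seq (.set 2 (var 13) (scaledCostE 0 colE)) (.set 3 (var 13) (scaledCostE 2 colE)))) <|
      assign 13 (var 13 + .lit 1)

theorem fill_runs {b D : ℕ} {M : Mem} (hr : 0 < M 0 1) (h6 : M 6 0 = D)
    (hb : M 0 1 * M 0 1 + M 0 1 + 1 < 2 ^ b)
    (hle : ∀ c i j, (c = 0 ∨ c = 2) → i < M 0 1 → 1 ≤ j → entry (M 0) D c j i < 2 ^ b) :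
    Runs b fill M (5 * (M 0 1 * M 0 1) + 2) (fun M' => ∀ j i, 1 ≤ j → j ≤ M 0 1 → i < M 0 1 →
      M' 2 (j * M 0 1 + i) = entry (M 0) D 0 j i ∧
        M' 3 (j * M 0 1 + i) = entry (M 0) D 2 j i) := by
  unfold fill
  refine (Runs.assign_seq (by simp only [eval_rE]; omega) <|
    -- Cell t holds row t / r and column t % r. Persons start at 1, so row 0 is left out and t runs
    -- from r to r² + r - 1.
    Runs.loop_upto (T := 4) (k₀ := M 0 1) (n := M 0 1 * M 0 1 + M 0 1)
      (Inv := fun k M' => M 0 1 ≤ k ∧ M' 13 0 = k ∧ ∀ t, M 0 1 ≤ t → t < k →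
        M' 2 t = entry (M 0) D 0 (t / M 0 1) (t % M 0 1) ∧
          M' 3 t = entry (M 0) D 2 (t / M 0 1) (t % M 0 1))
      (by omega) ?_ ?_ ?_).mono (by rw [Nat.add_sub_cancel]; omega) ?_
  · rintro k M' hf ⟨-, h13, -⟩
    have h0 : M' 0 = M 0 := by simpa [Mem.write_of_ne] using hf 0 (by decide)
    simp [h13, h0]
  · rintro k M' hf hk ⟨hrk, h13, hfill⟩
    have h0 : M' 0 = M 0 := by simpa [Mem.write_of_ne] using hf 0 (by decide)
    have h6' : M' 6 0 = D := by simpa [Mem.write_of_ne, h6] using congrFun (hf 6 (by decide)) 0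
    have hj : 1 ≤ k / M 0 1 := (Nat.one_le_div_iff hr).2 hrk
    have hi : k % M 0 1 < M 0 1 := Nat.mod_lt _ hr
    have hins : ∀ N : Mem, N 0 = M 0 → N 6 0 = D → N 13 0 = k → k / M 0 1 ≤ M 0 2 →
        ∀ c, (insertE c).eval N = entry (M 0) D c (k / M 0 1) (k % M 0 1) := by
      intro N e0 e6 e13 hle c
      rw [entry, if_pos hle]
      simp only [insertE, Expr.eval_add, eval_scaledCostE, Expr.eval_mul, eval_colE,
        eval_nextColE, eval_rE, eval_sE, Expr.eval_sub, Expr.eval_div, eval_var, Expr.eval_lit,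
        e0, e6, e13]
    have hkeep : ∀ N : Mem, N 0 = M 0 → N 6 0 = D → N 13 0 = k → ¬ k / M 0 1 ≤ M 0 2 →
        ∀ c, (scaledCostE c colE).eval N = entry (M 0) D c (k / M 0 1) (k % M 0 1) := by
      intro N e0 e6 e13 hle c
      rw [entry, if_neg hle]
      simp only [eval_scaledCostE, eval_colE, e0, e6, e13]
    have hset : ∀ e₀ e₂ : Expr,
        (∀ N : Mem, N 0 = M 0 → N 6 0 = D → N 13 0 = k →
          e₀.eval N = entry (M 0) D 0 (k / M 0 1) (k % M 0 1)) →
        (∀ N : Mem, N 0 = M 0 → N 6 0 = D → N 13 0 = k →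
          e₂.eval N = entry (M 0) D 2 (k / M 0 1) (k % M 0 1)) →
        Runs b (.seq (.set 2 (var 13) e₀) (.set 3 (var 13) e₂)) M' 2 (fun M'' =>
          M'' 13 0 = k ∧ ∀ t, M 0 1 ≤ t → t < k + 1 →
            M'' 2 t = entry (M 0) D 0 (t / M 0 1) (t % M 0 1) ∧
              M'' 3 t = entry (M 0) D 2 (t / M 0 1) (t % M 0 1)) := by
      intro e₀ e₂ he₀ he₂
      have he₂' := he₂ (M'.write 2 ((var 13).eval M') (e₀.eval M'))
        (by rw [Mem.write_of_ne _ _ _ (by decide), h0])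
        (by rw [Mem.write_of_ne _ _ _ (by decide), h6'])
        (by rw [Mem.write_of_ne _ _ _ (by decide), h13])
      refine Runs.set_seq (T := 1) ?_ <| Runs.set ?_ ?_
      · rw [he₀ M' h0 h6' h13]; exact hle 0 _ _ (Or.inl rfl) hi hj
      · rw [he₂']; exact hle 2 _ _ (Or.inr rfl) hi hj
      · rw [he₂', he₀ M' h0 h6' h13]
        refine ⟨by simpa [Mem.write_apply] using h13, fun t ht htk => ?_⟩
        simp only [Mem.write_apply, eval_var, h13]
        rcases Nat.lt_succ_iff_lt_or_eq.1 htk with htk | rfl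
        · have := hfill t ht htk
          simpa [htk.ne] using this
        · simp
    refine Runs.seq (T₁ := 3) (T₂ := 1)
      (P := fun M'' => M'' 13 0 = k ∧ ∀ t, M 0 1 ≤ t → t < k + 1 →
        M'' 2 t = entry (M 0) D 0 (t / M 0 1) (t % M 0 1) ∧
          M'' 3 t = entry (M 0) D 2 (t / M 0 1) (t % M 0 1))
      (Runs.ite (T := 2) (fun he => ?_) fun he => ?_) ?_
    · simp only [Expr.eval_sub, Expr.eval_add, Expr.eval_div, eval_var, eval_rE, eval_sE, h13, h0,
        Expr.eval_lit] at he
      exact hset _ _ (fun N a b c => hins N a b c (by omega) 0)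
        (fun N a b c => hins N a b c (by omega) 2)
    · simp only [Expr.eval_sub, Expr.eval_add, Expr.eval_div, eval_var, eval_rE, eval_sE, h13, h0,
        Expr.eval_lit] at he
      exact hset _ _ (fun N a b c => hkeep N a b c (by omega) 0)
        (fun N a b c => hkeep N a b c (by omega) 2)
    · rintro M'' ⟨h13', hfill'⟩
      refine Runs.assign ?_ ⟨by omega, ?_, ?_⟩
      · simp [h13']; omega
      · simp [h13']
      · simpa [Mem.write_of_ne] using hfill'
  · refine ⟨le_rfl, by simp, fun t h₁ h₂ => ?_⟩
    omega
  · rintro M' ⟨-, -, -, hfill⟩ j i hj hjr hi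
    have h₁ : j * M 0 1 ≤ M 0 1 * M 0 1 := Nat.mul_le_mul_right _ hjr
    have h₂ : 1 * M 0 1 ≤ j * M 0 1 := Nat.mul_le_mul_right _ hj
    have h₃ : (j * M 0 1 + i) / M 0 1 = j := by
      rw [mul_comm, Nat.mul_add_div hr, Nat.div_eq_of_lt hi, add_zero]
    have h₄ : (j * M 0 1 + i) % M 0 1 = i := by
      rw [mul_comm, Nat.mul_add_mod, Nat.mod_eq_of_lt hi]
    have := hfill (j * M 0 1 + i) (by omega) (by omega)
    rwa [h₃, h₄] at this

/-- The approximation scheme. -/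
def scheme : Cmd :=
  .seq multiply <| .seq fill <| .seq (assign 7 (.lit 8 * rE * (var 6 * var 6))) <|
    .seq (assign 10 (.lit 2 * (var 7 * var 7) + .lit 1)) search

/-- The cost of an assignment. -/
def entryCost (w : ℕ → ℕ) (D c : ℕ) (o : ℕ → ℕ) : ℕ := ∑ i ∈ range (w 1), entry w D c (o i) i

/-- A bound on the number of steps of the scheme. -/
def schemeSteps (r s n L : ℕ) : ℕ :=
  3 * (r + r * s) + 3 + (5 * (r * r) + 2 + (1 + (1 +
    (4 * n * L * (4 * n * L * (guessSteps r n + 2) + 4) + 2))))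

theorem scheme_runs {b S D L : ℕ} {M : Mem} (hr : 0 < M 0 1) (hn : 0 < M 0 0)
    (hw : DenPos (M 0) (M 0 1 + M 0 1 * M 0 2))
    (hD : commonMultiple (M 0) (M 0 1 + M 0 1 * M 0 2) = D) (hS : 8 * M 0 1 * (D * D) = S)
    (hL : S < 2 ^ L) (hb₁ : M 0 1 + M 0 1 * M 0 2 + 1 < 2 ^ b)
    (hb₂ : M 0 1 * M 0 1 + M 0 1 + 1 < 2 ^ b) (hb₃ : 2 * M 0 1 + 3 < 2 ^ b)
    (hW : 4 * (12 * M 0 1 * M 0 0) + 3 < 2 ^ b) (hSb : 2 * S + 1 < 2 ^ b)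
    (hSS : 2 * (S * S) + 1 < 2 ^ b) :
    Runs b scheme M (schemeSteps (M 0 1) (M 0 2) (M 0 0) L) (fun M' =>
      ∃ o, IsAssignment (M 0 1) o ∧ output M' = tourList (M 0 1) (M 0 2) o (M 0 1) ∧
        ∀ σ, IsAssignment (M 0 1) σ → M 0 0 * (entryCost (M 0) D 0 o * entryCost (M 0) D 2 o) ≤
          (M 0 0 + 1) * (entryCost (M 0) D 0 σ * entryCost (M 0) D 2 σ)) := by
  have hDpos : 0 < D := hD ▸ commonMultiple_pos hw
  have hDD : D ≤ D * D := Nat.le_mul_self D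
  have hS8 : 8 * (D * D) ≤ S := by
    rw [← hS, mul_right_comm]
    exact Nat.le_mul_of_pos_right _ hr
  have hentry : ∀ c i j, (c = 0 ∨ c = 2) → i < M 0 1 → 1 ≤ j →
      entry (M 0) D c j i ≤ 8 * (D * D) := by
    intro c i j hc hi hj
    have := entry_le hw hc hi hj
    rwa [hD] at this
  unfold scheme schemeSteps
  refine Runs.seq (multiply_runs hw hb₁ (by omega)).framed ?_
  rintro M₁ ⟨h6, hf₁⟩
  have h0 : M₁ 0 = M 0 := hf₁ 0 (by decide)
  rw [hD] at h6
  have hfill := (fill_runs (b := b) (M := M₁) (by rwa [h0]) h6 (by rwa [h0])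
    (by rw [h0]; exact fun c i j hc hi hj => (hentry c i j hc hi hj).trans_lt (by omega))).framed
  rw [h0] at hfill
  refine Runs.seq hfill ?_
  rintro M₂ ⟨hfilled, hf₂⟩
  have h0' : M₂ 0 = M 0 := (hf₂ 0 (by decide)).trans h0
  have h6' : M₂ 6 0 = D := by rw [hf₂ 6 (by decide), h6]
  have hcost : ∀ o, IsAssignment (M 0 1) o →
      assignCost (M₂ 2) (M 0 1) o = entryCost (M 0) D 0 o ∧
        assignCost (M₂ 3) (M 0 1) o = entryCost (M 0) D 2 o := by
    intro o ho
    constructor <;> refine Finset.sum_congr rfl fun i hi => ?_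
    · have hi := Finset.mem_range.1 hi
      exact (hfilled _ _ (ho.1 i hi).1 (ho.1 i hi).2 hi).1
    · have hi := Finset.mem_range.1 hi
      exact (hfilled _ _ (ho.1 i hi).1 (ho.1 i hi).2 hi).2
  have hcostle : ∀ c o, (c = 0 ∨ c = 2) → IsAssignment (M 0 1) o →
      entryCost (M 0) D c o ≤ S := by
    intro c o hc ho
    refine (Finset.sum_le_card_nsmul _ _ (8 * (D * D)) fun i hi => ?_).trans (le_of_eq ?_)
    · have hi := Finset.mem_range.1 hi
      exact hentry c i _ hc hi (ho.1 i hi).1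
    · rw [Finset.card_range, smul_eq_mul, ← hS]; ring
  have e7 : (.lit 8 * rE * (var 6 * var 6) : Expr).eval M₂ = S := by
    simp [h0', h6', hS]
  refine Runs.assign_seq (by rw [e7]; omega) ?_
  rw [e7]
  -- The initial best value is a sentinel larger than 2S²; `BestFound` claims nothing about it.
  have e10 : (.lit 2 * (var 7 * var 7) + .lit 1 : Expr).eval (M₂.write 7 0 S) = 2 * (S * S) + 1 := by simp
  refine Runs.assign_seq (by rw [e10]; omega) ?_
  rw [e10]
  obtain ⟨N, hN⟩ : ∃ N, N = (M₂.write 7 0 S).write 10 0 (2 * (S * S) + 1) := ⟨_, rfl⟩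
  rw [← hN]
  have n0 : N 0 = M 0 := by simp [hN, Mem.write_of_ne, h0']
  have n2 : N 2 = M₂ 2 := by simp [hN, Mem.write_of_ne]
  have n3 : N 3 = M₂ 3 := by simp [hN, Mem.write_of_ne]
  have n7 : N 7 0 = S := by simp [hN, Mem.write_apply]
  have n10 : N 10 0 = 2 * (S * S) + 1 := by simp [hN]
  have hready : CostsReady S N := by
    constructor
    · rwa [n0]
    · rwa [n0]
    · rw [n0, n2, n3]
      intro j i hj hjr hi
      obtain ⟨h₁, h₂⟩ := hfilled j i hj hjr hi
      rw [h₁, h₂]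
      exact ⟨four_dvd_entry _ _ _ _ _, four_dvd_entry _ _ _ _ _⟩
    · rw [n0, n2, n3]
      intro o ho
      rw [(hcost o ho).1, (hcost o ho).2]
      exact ⟨hcostle 0 o (Or.inl rfl) ho, hcostle 2 o (Or.inr rfl) ho⟩
  have hid : IsAssignment (M 0 1) (fun i => i + 1) :=
    ⟨fun i hi => ⟨Nat.succ_pos i, hi⟩, fun i _ i' _ h => by simpa using h⟩
  have hsearch := (search_runs (b := b) hready n7 (by omega) hL (by rwa [n0]) (by rwa [n0]) hSb
    (by omega) (fun h => absurd h (by rw [n10]; exact Nat.not_succ_le_self _))).framed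
  rw [n0, n2, n3] at hsearch
  refine hsearch.mono le_rfl ?_
  rintro M' ⟨⟨hbest, hopt⟩, hf'⟩
  have m0 : M' 0 = M 0 := (hf' 0 (by decide)).trans n0
  have m2 : M' 2 = M₂ 2 := (hf' 2 (by decide)).trans n2
  have m3 : M' 3 = M₂ 3 := (hf' 3 (by decide)).trans n3
  -- The identity assignment costs at most S in both matrices, so the final value is at most (1 +
  -- 1/n)S² ≤ 2S². The sentinel has therefore been replaced, and the output really is a tour.
  have hle : M' 10 0 ≤ 2 * (S * S) := by
    have h₁ := hopt _ hid
    have h₂ : assignCost (M₂ 2) (M 0 1) (fun i => i + 1) *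
        assignCost (M₂ 3) (M 0 1) (fun i => i + 1) ≤ S * S := by
      rw [(hcost _ hid).1, (hcost _ hid).2]
      exact Nat.mul_le_mul (hcostle 0 _ (Or.inl rfl) hid) (hcostle 2 _ (Or.inr rfl) hid)
    have h₃ : M 0 0 * M' 10 0 ≤ M 0 0 * (2 * (S * S)) :=
      calc M 0 0 * M' 10 0 ≤ (M 0 0 + 1) * (S * S) := h₁.trans (Nat.mul_le_mul_left _ h₂)
        _ ≤ (M 0 0 + M 0 0) * (S * S) := Nat.mul_le_mul_right _ (by omega)
        _ = M 0 0 * (2 * (S * S)) := by ring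
    exact Nat.le_of_mul_le_mul_left h₃ hn
  obtain ⟨o, ho, hval, hout⟩ := hbest hle
  rw [m0] at ho hval hout
  rw [m2, m3, (hcost o ho).1, (hcost o ho).2] at hval
  refine ⟨o, ho, hout, fun σ hσ => ?_⟩
  rw [hval, ← (hcost σ hσ).1, ← (hcost σ hσ).2]
  exact hopt σ hσ

end RAM

/-! ## Matching edge ejection tours -/

namespace MEE

variable {r s : ℕ}

theorem val_finRotate (i : Fin r) : (finRotate r i : ℕ) = (i + 1) % r := by
  cases r with
  | zero => exact i.elim0
  | succ n => simp [finRotate_apply, Fin.val_add]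

theorem finRotate_ne (hr : 3 ≤ r) (i : Fin r) : finRotate r i ≠ i := by
  intro h
  have h₁ := val_finRotate i
  rw [h] at h₁
  have := i.isLt
  rcases Nat.lt_or_ge (i + 1) r with h₂ | h₂
  · rw [Nat.mod_eq_of_lt h₂] at h₁; omega
  · have : (i : ℕ) + 1 = r := by omega
    rw [this, Nat.mod_self] at h₁; omega

theorem finRotate_finRotate_ne (hr : 3 ≤ r) (i : Fin r) : finRotate r (finRotate r i) ≠ i := by
  intro h
  have h₁ := val_finRotate (finRotate r i)
  rw [h, val_finRotate, Nat.mod_add_mod] at h₁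
  have := i.isLt
  rcases Nat.lt_or_ge (i + 1 + 1) r with h₂ | h₂
  · rw [Nat.mod_eq_of_lt h₂] at h₁; omega
  · rw [Nat.mod_eq_sub_mod h₂, Nat.mod_eq_of_lt (by omega)] at h₁; omega

/-- Reversing an edge would mean returning to u_i after two steps, which r ≥ 3 excludes. -/
theorem cycEdge_injective (hr : 3 ≤ r) : Function.Injective (cycEdge r s) := by
  intro i i' h
  simp only [cycEdge, Sym2.eq_iff, Sum.inl.injEq] at h
  rcases h with ⟨h, -⟩ | ⟨h₁, h₂⟩
  · exact h
  · subst h₁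
    exact absurd h₂ (finRotate_finRotate_ne hr i')

/-! ### The Hamiltonian cycle as a chain of segments -/

/-- The edges between `u_i` and `u_{i+1}` on the tour. -/
noncomputable def segEdges (π : Fin s ↪ Fin r) (i : Fin r) : List (Sym2 (Vert r s)) :=
  open Classical in
  if h : ∃ j, π j = i then [crossEdge i h.choose, crossEdge (finRotate r i) h.choose]
  else [cycEdge r s i]

/-- The vertices after `u_i`, up to `u_{i+1}`, on the tour. -/
noncomputable def segVerts (π : Fin s ↪ Fin r) (i : Fin r) : List (Vert r s) :=
  open Classical in
  if h : ∃ j, π j = i then [Sum.inr h.choose, Sum.inl (finRotate r i)]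
  else [Sum.inl (finRotate r i)]

theorem segEdges_apply (π : Fin s ↪ Fin r) (j : Fin s) :
    segEdges π (π j) = [crossEdge (π j) j, crossEdge (finRotate r (π j)) j] := by
  have h : ∃ j', π j' = π j := ⟨j, rfl⟩
  have hc : h.choose = j := π.injective h.choose_spec
  rw [segEdges, dif_pos h, hc]

theorem segEdges_of_ne {π : Fin s ↪ Fin r} {i : Fin r} (h : ∀ j, π j ≠ i) :
    segEdges π i = [cycEdge r s i] := by
  rw [segEdges, dif_neg (by simpa using h)]

theorem segVerts_apply (π : Fin s ↪ Fin r) (j : Fin s) :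
    segVerts π (π j) = [Sum.inr j, Sum.inl (finRotate r (π j))] := by
  have h : ∃ j', π j' = π j := ⟨j, rfl⟩
  have hc : h.choose = j := π.injective h.choose_spec
  rw [segVerts, dif_pos h, hc]

theorem segVerts_of_ne {π : Fin s ↪ Fin r} {i : Fin r} (h : ∀ j, π j ≠ i) :
    segVerts π i = [Sum.inl (finRotate r i)] := by
  rw [segVerts, dif_neg (by simpa using h)]

theorem mem_segVerts {π : Fin s ↪ Fin r} {i : Fin r} {x : Vert r s} :
    x ∈ segVerts π i ↔ x = Sum.inl (finRotate r i) ∨ ∃ j, π j = i ∧ x = Sum.inr j := by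
  by_cases h : ∃ j, π j = i
  · obtain ⟨j, rfl⟩ := h
    rw [segVerts_apply]
    simp [or_comm]
  · push Not at h
    rw [segVerts_of_ne h]
    simp [h]

theorem mem_segEdges {π : Fin s ↪ Fin r} {i : Fin r} {e : Sym2 (Vert r s)} :
    e ∈ segEdges π i ↔ ((∀ j, π j ≠ i) ∧ e = cycEdge r s i) ∨
      ∃ j, π j = i ∧ (e = crossEdge i j ∨ e = crossEdge (finRotate r i) j) := by
  by_cases h : ∃ j, π j = i
  · obtain ⟨j, rfl⟩ := h
    rw [segEdges_apply]
    simp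
  · push Not at h
    rw [segEdges_of_ne h]
    simp [h]

theorem nodup_segVerts (π : Fin s ↪ Fin r) : ((List.finRange r).flatMap (segVerts π)).Nodup := by
  rw [List.nodup_flatMap]
  refine ⟨fun i _ => ?_, (List.nodup_finRange r).imp ?_⟩
  · by_cases h : ∃ j, π j = i
    · obtain ⟨j, rfl⟩ := h
      simp [segVerts_apply]
    · push Not at h
      simp [segVerts_of_ne h]
  · intro i i' hne x hx hx'
    rw [mem_segVerts] at hx hx'
    rcases hx with rfl | ⟨j, rfl, rfl⟩ <;> rcases hx' with hx' | ⟨j', rfl, hx'⟩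
    · exact hne ((finRotate r).injective (Sum.inl.inj hx'))
    · exact absurd hx' (by simp)
    · exact absurd hx' (by simp)
    · exact hne (by rw [Sum.inr.inj hx'])

theorem mem_flatMap_segVerts (π : Fin s ↪ Fin r) (x : Vert r s) :
    x ∈ (List.finRange r).flatMap (segVerts π) := by
  simp only [List.mem_flatMap, List.mem_finRange, true_and, mem_segVerts]
  rcases x with i | j
  · exact ⟨(finRotate r).symm i, Or.inl (by rw [Equiv.apply_symm_apply])⟩
  · exact ⟨π j, Or.inr ⟨j, rfl, rfl⟩⟩

theorem toFinset_segEdges (hr : 3 ≤ r) (π : Fin s ↪ Fin r) :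
    ((List.finRange r).flatMap (segEdges π)).toFinset = ejectInsert π := by
  ext e
  simp only [List.mem_toFinset, List.mem_flatMap, List.mem_finRange, true_and, mem_segEdges,
    ejectInsert, Finset.mem_union, Finset.mem_sdiff, Finset.mem_image, Finset.mem_univ,
    Finset.mem_biUnion, Finset.mem_insert, Finset.mem_singleton]
  constructor
  · rintro ⟨i, ⟨h, rfl⟩ | ⟨j, rfl, h⟩⟩
    · refine Or.inl ⟨⟨i, rfl⟩, ?_⟩
      rintro ⟨j, hj⟩
      exact h j (cycEdge_injective hr hj)
    · exact Or.inr ⟨j, h⟩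
  · rintro (⟨⟨i, rfl⟩, h⟩ | ⟨j, h⟩)
    · refine ⟨i, Or.inl ⟨?_, rfl⟩⟩
      rintro j rfl
      exact h ⟨j, rfl⟩
    · exact ⟨π j, Or.inr ⟨j, rfl, h⟩⟩

theorem cycEdge_mem (hr : 3 ≤ r) (i : Fin r) : cycEdge r s i ∈ (graph r s).edgeSet := by
  rw [graph, SimpleGraph.edgeSet_fromEdgeSet]
  refine ⟨Or.inl ⟨i, rfl⟩, ?_⟩
  simpa [cycEdge] using (finRotate_ne hr i).symm

theorem crossEdge_mem (i : Fin r) (j : Fin s) : crossEdge i j ∈ (graph r s).edgeSet := by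
  rw [graph, SimpleGraph.edgeSet_fromEdgeSet]
  exact ⟨Or.inr ⟨i, j, rfl⟩, by simp [crossEdge]⟩

theorem exists_segWalk (hr : 3 ≤ r) (π : Fin s ↪ Fin r) (i : Fin r) :
    ∃ p : (graph r s).Walk (Sum.inl i) (Sum.inl (finRotate r i)),
      p.edges = segEdges π i ∧ p.support.tail = segVerts π i := by
  by_cases h : ∃ j, π j = i
  · obtain ⟨j, rfl⟩ := h
    have h₁ : (graph r s).Adj (Sum.inl (π j)) (Sum.inr j) := crossEdge_mem (π j) j
    have h₂ : (graph r s).Adj (Sum.inl (finRotate r (π j))) (Sum.inr j) :=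
      crossEdge_mem (finRotate r (π j)) j
    refine ⟨.cons h₁ (.cons h₂.symm .nil), ?_, ?_⟩
    · rw [segEdges_apply]
      simp [crossEdge, Sym2.eq_swap]
    · rw [segVerts_apply]
      simp
  · push Not at h
    have h₁ : (graph r s).Adj (Sum.inl i) (Sum.inl (finRotate r i)) := cycEdge_mem hr i
    refine ⟨.cons h₁ .nil, ?_, ?_⟩
    · rw [segEdges_of_ne h]
      simp [cycEdge]
    · rw [segVerts_of_ne h]
      simp

/-- The vertex `u_k`, with indices modulo `r`. -/
def cycVert (hr : 3 ≤ r) (k : ℕ) : Fin r := ⟨k % r, Nat.mod_lt _ (by omega)⟩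

theorem finRotate_cycVert (hr : 3 ≤ r) (k : ℕ) :
    finRotate r (cycVert hr k) = cycVert hr (k + 1) := by
  ext
  rw [val_finRotate]
  simp [cycVert]

theorem map_cycVert_range (hr : 3 ≤ r) : (List.range r).map (cycVert hr) = List.finRange r := by
  refine List.ext_getElem (by simp) fun k h₁ h₂ => ?_
  ext
  simp only [List.length_map, List.length_range] at h₁
  simp [cycVert, Nat.mod_eq_of_lt h₁]

/-- Induction needs a walk with free end point, indexed by natural numbers modulo r; it closes up at
k = r. -/
theorem exists_prefixWalk (hr : 3 ≤ r) (π : Fin s ↪ Fin r) (k : ℕ) :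
    ∃ p : (graph r s).Walk (Sum.inl (cycVert hr 0)) (Sum.inl (cycVert hr k)),
      p.edges = ((List.range k).map (cycVert hr)).flatMap (segEdges π) ∧
        p.support.tail = ((List.range k).map (cycVert hr)).flatMap (segVerts π) := by
  induction k with
  | zero => exact ⟨.nil, by simp⟩
  | succ k ih =>
    obtain ⟨p, hp₁, hp₂⟩ := ih
    obtain ⟨q, hq₁, hq₂⟩ := exists_segWalk hr π (cycVert hr k)
    have hk := congrArg (Sum.inl (β := Fin s)) (finRotate_cycVert hr k)
    refine ⟨p.append (q.copy rfl hk), ?_, ?_⟩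
    · simp [hp₁, hq₁, List.range_succ]
    · rw [SimpleGraph.Walk.tail_support_append, hp₂, SimpleGraph.Walk.support_copy, hq₂]
      simp [List.range_succ]

/-- Ejecting and inserting yields a Hamiltonian cycle. -/
theorem exists_hamiltonianCycle (hr : 3 ≤ r) (π : Fin s ↪ Fin r) :
    ∃ (u : Vert r s) (p : (graph r s).Walk u u), p.IsHamiltonianCycle ∧
      p.edges = (List.finRange r).flatMap (segEdges π) ∧
        p.support.tail = (List.finRange r).flatMap (segVerts π) := by
  obtain ⟨p, hp₁, hp₂⟩ := exists_prefixWalk hr π r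
  have hclose : Sum.inl (β := Fin s) (cycVert hr r) = Sum.inl (cycVert hr 0) := by
    simp [cycVert]
  rw [map_cycVert_range] at hp₁ hp₂
  obtain ⟨q, hq₁, hq₂⟩ : ∃ q : (graph r s).Walk (Sum.inl (cycVert hr 0)) (Sum.inl (cycVert hr 0)),
      q.edges = (List.finRange r).flatMap (segEdges π) ∧
        q.support.tail = (List.finRange r).flatMap (segVerts π) :=
    ⟨p.copy rfl hclose, by simpa using hp₁, by simpa using hp₂⟩
  have hnd := nodup_segVerts π
  have hmem := mem_flatMap_segVerts π
  rw [← hq₂] at hnd hmem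
  have hlen : q.length = r + s := by
    have h₁ : q.support.tail.toFinset = Finset.univ :=
      Finset.eq_univ_iff_forall.2 fun x => List.mem_toFinset.2 (hmem x)
    have h₂ := List.toFinset_card_of_nodup hnd
    rw [h₁, Finset.card_univ, List.length_tail, SimpleGraph.Walk.length_support] at h₂
    simpa using h₂.symm
  have hnil : ¬ q.Nil := by
    rw [← SimpleGraph.Walk.length_eq_zero_iff]
    omega
  -- Without its first vertex the closed walk visits every vertex once, and its length r + s is at
  -- least 3.
  have hcyc : q.IsCycle := by
    rw [SimpleGraph.Walk.isCycle_iff_isPath_tail_and_le_length, SimpleGraph.Walk.isPath_def,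
      SimpleGraph.Walk.support_tail_of_not_nil _ hnil]
    exact ⟨hnd, by omega⟩
  refine ⟨_, q, ?_, hq₁, hq₂⟩
  rw [SimpleGraph.Walk.isHamiltonianCycle_iff_isCycle_and_length_eq]
  exact ⟨hcyc, by simp [hlen]⟩

theorem ejectInsert_mem_tours (hr : 3 ≤ r) (π : Fin s ↪ Fin r) : ejectInsert π ∈ tours r s := by
  obtain ⟨u, p, hp, he, -⟩ := exists_hamiltonianCycle hr π
  exact ⟨⟨u, p, hp, by rw [he, toFinset_segEdges hr]⟩, π, rfl⟩

theorem describes_ejectInsert (hr : 3 ≤ r) (π : Fin s ↪ Fin r) :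
    Describes (((List.finRange r).flatMap (segVerts π)).map vertNum) (ejectInsert π) := by
  obtain ⟨u, p, hp, he, hs⟩ := exists_hamiltonianCycle hr π
  exact ⟨u, p, hp, by rw [he, toFinset_segEdges hr], by rw [hs]⟩

/-- A cycle repeats no edge, so the sum over the edge set equals the sum along the walk, which
splits into segments. This makes the cost of a tour an assignment cost. -/
theorem sum_ejectInsert (hr : 3 ≤ r) (π : Fin s ↪ Fin r) (f : Sym2 (Vert r s) → ℚ) :
    ∑ e ∈ ejectInsert π, f e = ∑ i, ((segEdges π i).map f).sum := by
  obtain ⟨u, p, hp, he, -⟩ := exists_hamiltonianCycle hr π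
  have hnd := hp.isCycle.edges_nodup
  rw [he] at hnd
  rw [← toFinset_segEdges hr, List.sum_toFinset _ hnd, List.map_flatMap, List.flatMap_def,
    List.sum_flatten, List.map_map, ← List.sum_toFinset _ (List.nodup_finRange r)]
  simp

/-! ### Tours as assignments -/

/-- The assignment `o` inserts `v_j` where `π` does. -/
def Represents (π : Fin s ↪ Fin r) (o : ℕ → ℕ) : Prop :=
  ∀ (i : Fin r) (j : Fin s), o i = j + 1 ↔ π j = i

theorem exists_represents_of_isAssignment (hs : s ≤ r) {o : ℕ → ℕ} (ho : IsAssignment r o) :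
    ∃ π : Fin s ↪ Fin r, Represents π o := by
  have h : ∀ j : Fin s, ∃ i : Fin r, o i = j + 1 := by
    intro j
    obtain ⟨i, hi, h⟩ := ho.exists_eq (j := j + 1) (by omega) (by omega)
    exact ⟨⟨i, hi⟩, h⟩
  choose f hf using h
  refine ⟨⟨f, fun j j' hj => ?_⟩, fun i j => ⟨fun h => ?_, ?_⟩⟩
  · have h₁ := hf j
    rw [hj, hf j'] at h₁
    exact Fin.ext (by omega)
  · exact Fin.ext (ho.2 (f j).isLt i.isLt ((hf j).trans h.symm))
  · rintro rfl
    exact hf j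

/-- Extend π to a permutation of all r indices, letting dummies take the edges that stay; the
assignment is the inverse permutation, shifted by 1. The default value of the function outside i < s
plays no role. -/
theorem exists_isAssignment_represents (hs : s ≤ r) (π : Fin s ↪ Fin r) :
    ∃ o, IsAssignment r o ∧ Represents π o := by
  classical
  obtain ⟨g, hg⟩ := Finset.exists_equiv_extend_of_card_eq (α := Fin r) (β := Fin r)
    (t := Finset.univ) (by simp) (s := Finset.univ.filter fun i : Fin r => (i : ℕ) < s)
    (f := fun i => if h : (i : ℕ) < s then π ⟨i, h⟩ else i) (Finset.subset_univ _) (by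
      intro i hi i' hi' h
      simp only [Finset.coe_filter, Finset.mem_univ, true_and, Set.mem_ofPred_eq] at hi hi'
      simp only [hi, hi', dif_pos] at h
      have := π.injective h
      exact Fin.ext (by simpa using this))
  let G : Fin r ≃ Fin r := g.trans (Equiv.subtypeUnivEquiv fun x => Finset.mem_univ x)
  have hG : ∀ j : Fin s, G (Fin.castLE hs j) = π j := by
    intro j
    have := hg (Fin.castLE hs j) (by simp)
    simpa [G] using this
  refine ⟨fun i => if h : i < r then (G.symm ⟨i, h⟩ : ℕ) + 1 else 0, ⟨?_, ?_⟩, ?_⟩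
  · intro i hi
    simp only [hi, dif_pos]
    have := (G.symm ⟨i, hi⟩).isLt
    omega
  · intro i hi i' hi' h
    simp only [Set.mem_Iio] at hi hi'
    simp only [hi, hi', dif_pos, add_left_inj] at h
    simpa using G.symm.injective (Fin.ext h)
  · intro i j
    simp only [i.isLt, dif_pos, add_left_inj, Fin.eta]
    rw [← hG j]
    constructor
    · intro h
      have : G.symm i = Fin.castLE hs j := Fin.ext h
      rw [← this, Equiv.apply_symm_apply]
    · rintro rfl
      simp

theorem Represents.exists_eq_of_le {π : Fin s ↪ Fin r} {o : ℕ → ℕ} (h : Represents π o)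
    (ho : IsAssignment r o) {i : Fin r} (hi : o i ≤ s) : ∃ j : Fin s, π j = i ∧ o i = j + 1 := by
  have h₁ := (ho.1 i i.isLt).1
  have h₂ : o i = (⟨o i - 1, by omega⟩ : Fin s) + 1 := by simp; omega
  exact ⟨_, (h i _).1 h₂, h₂⟩

theorem Represents.ne_of_lt {π : Fin s ↪ Fin r} {o : ℕ → ℕ} (h : Represents π o)
    {i : Fin r} (hi : ¬ o i ≤ s) (j : Fin s) : π j ≠ i := by
  intro hj
  have := (h i j).2 hj
  omega

/-- Person j is the vertex number r + j - 1. Both lists omit the starting vertex u_1 and end with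
it, since the closed walk is described by the tail of its support. -/
theorem Represents.tourList_eq {π : Fin s ↪ Fin r} {o : ℕ → ℕ} (h : Represents π o)
    (ho : IsAssignment r o) : RAM.tourList r s o r =
      ((List.finRange r).flatMap (segVerts π)).map vertNum := by
  rw [RAM.tourList, List.map_flatMap, ← List.map_coe_finRange_eq_range, List.flatMap_map]
  refine List.flatMap_congr fun i _ => ?_
  split_ifs with hi
  · obtain ⟨j, rfl, hj⟩ := h.exists_eq_of_le ho hi
    rw [segVerts_apply, hj]
    simp [vertNum, val_finRotate, -finRotate_apply]
  · rw [segVerts_of_ne (h.ne_of_lt hi)]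
    simp [vertNum, val_finRotate, -finRotate_apply]

end MEE

/-! ## The encoding of instances -/

theorem List.getD_flatMap_finRange {r n : ℕ} (f : Fin r → List ℕ) (hf : ∀ i, (f i).length = n)
    (i : Fin r) {c : ℕ} (hc : c < n) :
    ((List.finRange r).flatMap f).getD (n * i + c) 0 = (f i).getD c 0 := by
  induction r with
  | zero => exact i.elim0
  | succ r ih =>
    rw [List.finRange_succ, List.flatMap_cons, List.flatMap_map]
    induction i using Fin.cases with
    | zero =>
      rw [List.getD_append _ _ _ _ (by simpa [hf] using hc)]
      simp
    | succ i =>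
      rw [List.getD_append_right _ _ _ _ (by rw [hf, Fin.val_succ]; nlinarith)]
      have : n * (i.succ : ℕ) + c - (f 0).length = n * i + c := by
        rw [hf, Fin.val_succ, mul_add, mul_one]
        omega
      rw [this]
      exact ih (fun i => f i.succ) (fun i => hf i.succ) i

theorem List.length_flatMap_finRange {r n : ℕ} (f : Fin r → List ℕ)
    (hf : ∀ i, (f i).length = n) : ((List.finRange r).flatMap f).length = r * n := by
  simp [List.length_flatMap, hf]

theorem List.sum_map_eq_sum_range (l : List ℕ) (g : ℕ → ℕ) :
    (l.map g).sum = ∑ k ∈ Finset.range l.length, g (l.getD k 0) := by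
  induction l with
  | nil => simp
  | cons a l ih =>
    rw [List.map_cons, List.sum_cons, ih, List.length_cons, Finset.sum_range_succ']
    simp [add_comm]

theorem Finset.sum_range_four_mul (E : ℕ) (g : ℕ → ℕ) : ∑ k ∈ Finset.range (4 * E), g k =
    ∑ m ∈ Finset.range E, (g (4 * m) + g (4 * m + 1) + g (4 * m + 2) + g (4 * m + 3)) := by
  induction E with
  | zero => simp
  | succ E ih =>
    rw [Finset.sum_range_succ, ← ih, mul_add, mul_one, Finset.sum_range_succ,
      Finset.sum_range_succ, Finset.sum_range_succ, Finset.sum_range_succ]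
    ring

namespace RAM

theorem size_lt_wordSize {w : List ℕ} {n : ℕ} (h : n ∈ w) : n.size < wordSize w :=
  List.single_le_sum (by simp) (n.size + 1) (List.mem_map.2 ⟨n, h, rfl⟩)

theorem getD_lt_two_pow (w : List ℕ) (i : ℕ) : w.getD i 0 < 2 ^ wordSize w := by
  rcases Nat.lt_or_ge i w.length with h | h
  · rw [List.getD_eq_getElem _ _ h]
    exact (Nat.lt_size_self _).trans_le
      (Nat.pow_le_pow_right (by norm_num) (size_lt_wordSize (List.getElem_mem h)).le)
  · rw [List.getD_eq_default _ _ h]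
    positivity

theorem length_le_wordSize (w : List ℕ) : w.length ≤ wordSize w := by
  induction w with
  | nil => simp
  | cons a w ih =>
    simp only [wordSize, List.map_cons, List.sum_cons, List.length_cons] at *
    omega

theorem bounded_initMem (w : List ℕ) : Bounded (wordSize w) (initMem w) := by
  intro x i
  unfold initMem
  split_ifs
  · exact getD_lt_two_pow w i
  · positivity

/-- Each word n contributes a factor at most n + 1 ≤ 2 ^ (size + 1), and these exponents are exactly
the summands of `wordSize`. -/
theorem commonMultiple_le {w : ℕ → ℕ} {l : List ℕ} {E : ℕ} (hl : l.length = 4 * E)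
    (hw : ∀ k, w (3 + k) = l.getD k 0) : commonMultiple w E ≤ 2 ^ wordSize l := by
  unfold wordSize commonMultiple
  rw [List.sum_map_eq_sum_range, hl, Finset.sum_range_four_mul, ← Finset.prod_pow_eq_pow_sum]
  refine Finset.prod_le_prod' fun m _ => ?_
  have h : ∀ n : ℕ, n + 1 ≤ 2 ^ (n.size + 1) := fun n =>
    (Nat.lt_size_self n).trans_le (Nat.pow_le_pow_right (by norm_num) (by omega))
  have h' : ∀ n : ℕ, n ≤ 2 ^ (n.size + 1) := fun n => (Nat.le_succ n).trans (h n)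
  have e₁ := hw (4 * m)
  have e₂ := (congrArg w (by ring : 4 + 4 * m = 3 + (4 * m + 1))).trans (hw _)
  have e₃ := (congrArg w (by ring : 5 + 4 * m = 3 + (4 * m + 2))).trans (hw _)
  have e₄ := (congrArg w (by ring : 6 + 4 * m = 3 + (4 * m + 3))).trans (hw _)
  rw [blockProd, e₁, e₂, e₃, e₄, add_assoc, pow_add, pow_add]
  gcongr
  · exact h _
  · exact h' _
  · rw [pow_add]
    gcongr
    · exact h _
    · exact h' _

end RAM

/-! ### From input words to edge costs -/

namespace MEE

namespace Instance

variable (I : Instance)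

/-- The words that encode the edge costs. -/
def costWords : List ℕ :=
  (List.finRange I.r).flatMap (fun i => I.edgeWords (cycEdge I.r I.s i)) ++
    (List.finRange I.r).flatMap fun i =>
      (List.finRange I.s).flatMap fun j => I.edgeWords (crossEdge i j)

theorem encode_eq : I.encode = I.r :: I.s :: I.costWords := rfl

theorem length_costWords : I.costWords.length = 4 * (I.r + I.r * I.s) := by
  unfold costWords
  rw [List.length_append, List.length_flatMap_finRange (n := 4) _ (fun _ => rfl),
    List.length_flatMap_finRange (n := I.s * 4) _
      (fun i => List.length_flatMap_finRange (n := 4) _ fun _ => rfl)]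
  ring

theorem getD_costWords_cyc (i : Fin I.r) {c : ℕ} (hc : c < 4) :
    I.costWords.getD (4 * i + c) 0 = (I.edgeWords (cycEdge I.r I.s i)).getD c 0 := by
  unfold costWords
  rw [List.getD_append _ _ _ _ (by
    rw [List.length_flatMap_finRange (n := 4) _ (fun _ => rfl)]; omega)]
  exact List.getD_flatMap_finRange (n := 4) _ (fun _ => rfl) i hc

theorem getD_costWords_cross (i : Fin I.r) (j : Fin I.s) {c : ℕ} (hc : c < 4) :
    I.costWords.getD (4 * (I.r + i * I.s + j) + c) 0 =
      (I.edgeWords (crossEdge i j)).getD c 0 := by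
  unfold costWords
  have hlen := List.length_flatMap_finRange (n := 4)
    (fun i => I.edgeWords (cycEdge I.r I.s i)) (fun _ => rfl)
  rw [List.getD_append_right _ _ _ _ (by rw [hlen]; nlinarith [Nat.zero_le (i * I.s)]), hlen]
  have hidx : 4 * (I.r + i * I.s + j) + c - I.r * 4 = (I.s * 4) * i + (4 * j + c) := by
    have : 4 * (I.r + i * I.s + j) + c = I.r * 4 + ((I.s * 4) * i + (4 * j + c)) := by ring
    omega
  rw [hidx, List.getD_flatMap_finRange (n := I.s * 4) _
    (fun i => List.length_flatMap_finRange (n := 4) _ fun _ => rfl) i (by omega)]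
  exact List.getD_flatMap_finRange (n := 4) _ (fun _ => rfl) j hc

/-- The memory bank with the input. -/
def input (n : ℕ) : ℕ → ℕ := RAM.initMem (n :: I.encode) 0

variable (n : ℕ)

theorem input_one : I.input n 1 = I.r := rfl
theorem input_two : I.input n 2 = I.s := rfl

theorem input_add_three (k : ℕ) : I.input n (3 + k) = I.costWords.getD k 0 := by
  rw [add_comm]
  rfl

/-- The edge that is described by the `m`-th block of words. -/
def IsEdgeNumber (m : ℕ) (e : Sym2 (Vert I.r I.s)) : Prop :=
  e ∈ (graph I.r I.s).edgeSet ∧ m < I.r + I.r * I.s ∧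
    ∀ c < 4, I.input n (3 + (4 * m + c)) = (I.edgeWords e).getD c 0

theorem isEdgeNumber_cyc (i : Fin I.r) : I.IsEdgeNumber n i (cycEdge I.r I.s i) := by
  refine ⟨cycEdge_mem I.three_le i, by omega, fun c hc => ?_⟩
  rw [input_add_three, getD_costWords_cyc _ _ hc]

theorem isEdgeNumber_cross (i : Fin I.r) (j : Fin I.s) :
    I.IsEdgeNumber n (I.r + i * I.s + j) (crossEdge i j) := by
  refine ⟨crossEdge_mem i j, ?_, fun c hc => ?_⟩
  · have := RAM.crossIndex_lt (s := I.s) i.isLt (j := j + 1) (by omega) (by omega)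
    simpa using this
  · rw [input_add_three, getD_costWords_cross _ _ _ hc]

/-- Every block of four words comes from an edge, so its denominators are positive; the common
multiple is then nonzero. -/
theorem exists_isEdgeNumber {m : ℕ} (hm : m < I.r + I.r * I.s) : ∃ e, I.IsEdgeNumber n m e := by
  rcases Nat.lt_or_ge m I.r with h | h
  · exact ⟨_, I.isEdgeNumber_cyc n ⟨m, h⟩⟩
  · have hs : 0 < I.s := by
      rcases Nat.eq_zero_or_pos I.s with h0 | h0
      · rw [h0] at hm; omega
      · exact h0
    have hdiv := Nat.div_add_mod (m - I.r) I.s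
    have h₁ : (m - I.r) / I.s < I.r := by
      rw [Nat.div_lt_iff_lt_mul hs]; omega
    have := I.isEdgeNumber_cross n ⟨_, h₁⟩ ⟨_, Nat.mod_lt (m - I.r) hs⟩
    have hm' : I.r + (m - I.r) / I.s * I.s + (m - I.r) % I.s = m := by
      rw [mul_comm]; omega
    simp only [hm'] at this
    exact ⟨_, this⟩

theorem denPos_input : RAM.DenPos (I.input n) (I.r + I.r * I.s) := by
  intro m hm
  obtain ⟨e, -, -, he⟩ := I.exists_isEdgeNumber n hm
  have h₁ := he 1 (by norm_num)
  have h₃ := he 3 (by norm_num)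
  have e₁ : 3 + (4 * m + 1) = 4 + 4 * m := by ring
  have e₃ : 3 + (4 * m + 3) = 6 + 4 * m := by ring
  rw [e₁] at h₁
  rw [e₃] at h₃
  rw [h₁, h₃]
  exact ⟨(I.a e).den_pos, (I.b e).den_pos⟩

/-- The common multiple of the denominators. -/
def multiple : ℕ := RAM.commonMultiple (I.input n) (I.r + I.r * I.s)

theorem multiple_pos : 0 < I.multiple n := RAM.commonMultiple_pos (I.denPos_input n)

theorem multiple_le : I.multiple n ≤ 2 ^ RAM.wordSize I.costWords :=
  RAM.commonMultiple_le I.length_costWords (I.input_add_three n)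

theorem cast_four_mul_num_mul_div {q : ℚ} (hq : 0 ≤ q) {D : ℕ} (hD : q.den ∣ D) :
    ((4 * q.num.toNat * (D / q.den) : ℕ) : ℚ) = 4 * D * q := by
  have hnum : ((q.num.toNat : ℕ) : ℚ) = q.num := by
    have : ((q.num.toNat : ℕ) : ℤ) = q.num := Int.toNat_of_nonneg (Rat.num_nonneg.2 hq)
    exact_mod_cast this
  have hden : (q.den : ℚ) ≠ 0 := by exact_mod_cast q.den_pos.ne'
  push_cast [Nat.cast_div hD hden]
  rw [hnum]
  nth_rewrite 3 [← Rat.num_div_den q]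
  field_simp

variable {I n}

theorem IsEdgeNumber.scaledCost_a {m : ℕ} {e : Sym2 (Vert I.r I.s)}
    (h : I.IsEdgeNumber n m e) :
    (RAM.scaledCost (I.input n) (I.multiple n) 0 m : ℚ) = 4 * I.multiple n * I.a e := by
  obtain ⟨hmem, hm, he⟩ := h
  have h₀ : I.input n (3 + 0 + 4 * m) = (I.a e).num.toNat :=
    (congrArg (I.input n) (by ring)).trans (he 0 (by norm_num))
  have h₁ : I.input n (4 + 0 + 4 * m) = (I.a e).den :=
    (congrArg (I.input n) (by ring)).trans (he 1 (by norm_num))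
  have hd := RAM.den_dvd (w := I.input n) hm (Or.inl rfl)
  rw [h₁] at hd
  rw [RAM.scaledCost, h₀, h₁]
  exact cast_four_mul_num_mul_div (I.a_nonneg e hmem) hd

theorem IsEdgeNumber.scaledCost_b {m : ℕ} {e : Sym2 (Vert I.r I.s)}
    (h : I.IsEdgeNumber n m e) :
    (RAM.scaledCost (I.input n) (I.multiple n) 2 m : ℚ) = 4 * I.multiple n * I.b e := by
  obtain ⟨hmem, hm, he⟩ := h
  have h₀ : I.input n (3 + 2 + 4 * m) = (I.b e).num.toNat :=
    (congrArg (I.input n) (by ring)).trans (he 2 (by norm_num))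
  have h₁ : I.input n (4 + 2 + 4 * m) = (I.b e).den :=
    (congrArg (I.input n) (by ring)).trans (he 3 (by norm_num))
  have hd := RAM.den_dvd (w := I.input n) hm (Or.inr rfl)
  rw [h₁] at hd
  rw [RAM.scaledCost, h₀, h₁]
  exact cast_four_mul_num_mul_div (I.b_nonneg e hmem) hd

/-- Scaled costs of assignments are scaled costs of tours. -/
theorem entryCost_eq {π : Fin I.s ↪ Fin I.r} {o : ℕ → ℕ} (h : Represents π o)
    (ho : IsAssignment I.r o) {c : ℕ} {f : Sym2 (Vert I.r I.s) → ℚ}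
    (hf : ∀ m e, I.IsEdgeNumber n m e →
      (RAM.scaledCost (I.input n) (I.multiple n) c m : ℚ) = 4 * I.multiple n * f e) :
    (RAM.entryCost (I.input n) (I.multiple n) c o : ℚ) =
      4 * I.multiple n * ∑ e ∈ ejectInsert π, f e := by
  rw [sum_ejectInsert I.three_le, RAM.entryCost, input_one, Finset.sum_range, Nat.cast_sum,
    Finset.mul_sum]
  refine Finset.sum_congr rfl fun i _ => ?_
  rw [RAM.entry, input_two, input_one]
  split_ifs with hi
  · obtain ⟨j, rfl, hj⟩ := h.exists_eq_of_le ho hi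
    rw [segEdges_apply, hj, ← val_finRotate, Nat.add_sub_cancel, Nat.cast_add,
      hf _ _ (I.isEdgeNumber_cross n _ _), hf _ _ (I.isEdgeNumber_cross n _ _)]
    simp [mul_add, -finRotate_apply]
  · rw [segEdges_of_ne (h.ne_of_lt hi), hf _ _ (I.isEdgeNumber_cyc n i)]
    simp

theorem entryCost_mul_entryCost {π : Fin I.s ↪ Fin I.r} {o : ℕ → ℕ} (h : Represents π o)
    (ho : IsAssignment I.r o) :
    ((RAM.entryCost (I.input n) (I.multiple n) 0 o *
      RAM.entryCost (I.input n) (I.multiple n) 2 o : ℕ) : ℚ) =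
      (4 * I.multiple n) ^ 2 * I.objective (ejectInsert π) := by
  rw [Nat.cast_mul, entryCost_eq h ho (f := I.a) fun m e he => he.scaledCost_a,
    entryCost_eq h ho (f := I.b) fun m e he => he.scaledCost_b, objective]
  ring

theorem objective_nonneg (π : Fin I.s ↪ Fin I.r) : 0 ≤ I.objective (ejectInsert π) := by
  have hmem : ∀ e ∈ ejectInsert π, e ∈ (graph I.r I.s).edgeSet := by
    intro e he
    rw [← toFinset_segEdges I.three_le] at he
    simp only [List.mem_toFinset, List.mem_flatMap, mem_segEdges] at he
    obtain ⟨i, -, ⟨-, rfl⟩ | ⟨j, -, rfl | rfl⟩⟩ := he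
    · exact cycEdge_mem I.three_le _
    · exact crossEdge_mem _ _
    · exact crossEdge_mem _ _
  exact mul_nonneg (Finset.sum_nonneg fun e he => I.a_nonneg e (hmem e he))
    (Finset.sum_nonneg fun e he => I.b_nonneg e (hmem e he))

end Instance

end MEE

/-! ## The running time -/

namespace RAM

theorem guessSteps_le {r n X : ℕ} (hX : 1 ≤ X) (hr : r ≤ X) (hn : n ≤ X) :
    guessSteps r n ≤ 1000 * X ^ 4 := by
  have h₁ : X ≤ X ^ 4 := Nat.le_self_pow (by norm_num) X
  have h₂ : X ^ 2 ≤ X ^ 4 := Nat.pow_le_pow_right hX (by norm_num)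
  have h₃ : X ^ 3 ≤ X ^ 4 := Nat.pow_le_pow_right hX (by norm_num)
  have h₀ : 1 ≤ X ^ 4 := Nat.one_le_pow _ _ hX
  calc guessSteps r n ≤ guessSteps X X := by unfold guessSteps; gcongr
    _ ≤ 1000 * X ^ 4 := by
      unfold guessSteps
      ring_nf
      omega

/-- Replace every parameter by X: two nested searches of at most 24X² passes around a guess of order
X⁴ give degree 8. -/
theorem schemeSteps_le {r s n L X : ℕ} (hX : 1 ≤ X) (hr : r ≤ X) (hs : s ≤ X) (hn : n ≤ X)
    (hL : L ≤ 6 * X) : schemeSteps r s n L ≤ 1000000 * X ^ 8 := by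
  have h₁ : X ≤ X ^ 8 := Nat.le_self_pow (by norm_num) X
  have h₂ : X ^ 2 ≤ X ^ 8 := Nat.pow_le_pow_right hX (by norm_num)
  have h₄ : X ^ 4 ≤ X ^ 8 := Nat.pow_le_pow_right hX (by norm_num)
  have h₀ : 1 ≤ X ^ 8 := Nat.one_le_pow _ _ hX
  have hg := guessSteps_le hX hr hn
  calc schemeSteps r s n L ≤ 3 * (X + X * X) + 3 + (5 * (X * X) + 2 + (1 + (1 +
        (4 * X * (6 * X) * (4 * X * (6 * X) * (1000 * X ^ 4 + 2) + 4) + 2)))) := by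
          unfold schemeSteps; gcongr
    _ ≤ 1000000 * X ^ 8 := by
      ring_nf
      omega

/-- The sizes of the numbers that occur in the scheme. -/
theorem scheme_bounds {r s n D S X : ℕ} (hX : 1 ≤ X) (hr : r ≤ X) (hs : s ≤ X) (hn : n ≤ X)
    (hD : D ≤ 2 ^ X) (hS : 8 * r * (D * D) = S) :
    S < 2 ^ (3 * X + 3) ∧ r + r * s + 1 < 2 ^ (6 * X + 20) ∧ r * r + r + 1 < 2 ^ (6 * X + 20) ∧
      2 * r + 3 < 2 ^ (6 * X + 20) ∧ 4 * (12 * r * n) + 3 < 2 ^ (6 * X + 20) ∧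
      2 * S + 1 < 2 ^ (6 * X + 20) ∧ 2 * (S * S) + 1 < 2 ^ (6 * X + 20) := by
  have hXY : X < 2 ^ X := Nat.lt_two_pow_self
  have e₁ : 2 ^ (3 * X + 3) = 8 * (2 ^ X) ^ 3 := by rw [pow_add, mul_comm 3 X, pow_mul]; ring
  have e₂ : 2 ^ (6 * X + 20) = 1048576 * (2 ^ X) ^ 6 := by
    rw [pow_add, mul_comm 6 X, pow_mul]; ring
  rw [e₁, e₂]
  -- All parameters are at most Y = 2 ^ X, so each quantity is a small polynomial in Y. The largest,
  -- S², has degree 6, which dictates the word length 6X + 20.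
  generalize 2 ^ X = Y at *
  have hY : 1 ≤ Y := by omega
  have hrY : r < Y := by omega
  have hsY : s ≤ Y := by omega
  have hnY : n ≤ Y := by omega
  have h₁ : Y ≤ Y ^ 6 := Nat.le_self_pow (by norm_num) Y
  have h₂ : Y ^ 2 ≤ Y ^ 6 := Nat.pow_le_pow_right hY (by norm_num)
  have h₃ : Y ^ 3 ≤ Y ^ 6 := Nat.pow_le_pow_right hY (by norm_num)
  have hrs : r * s ≤ Y ^ 2 := sq Y ▸ Nat.mul_le_mul hrY.le hsY
  have hrr : r * r ≤ Y ^ 2 := sq Y ▸ Nat.mul_le_mul hrY.le hrY.le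
  have hrn : r * n ≤ Y ^ 2 := sq Y ▸ Nat.mul_le_mul hrY.le hnY
  have hS' : S < 8 * Y ^ 3 := by
    calc S = 8 * (r * (D * D)) := by rw [← hS]; ring
      _ ≤ 8 * (r * (Y * Y)) :=
        Nat.mul_le_mul_left _ (Nat.mul_le_mul_left _ (Nat.mul_le_mul hD hD))
      _ < 8 * (Y * (Y * Y)) := by
        have hYY : 0 < Y * Y := Nat.mul_pos hY hY
        have := Nat.mul_lt_mul_of_pos_right hrY hYY
        omega
      _ = 8 * Y ^ 3 := by ring
  have hSS : S * S ≤ 64 * Y ^ 6 := by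
    calc S * S ≤ (8 * Y ^ 3) * (8 * Y ^ 3) := Nat.mul_le_mul hS'.le hS'.le
      _ = 64 * Y ^ 6 := by ring
  have hassoc : 12 * r * n = 12 * (r * n) := mul_assoc _ _ _
  clear hS
  generalize Y ^ 6 = Y₆ at *
  generalize Y ^ 3 = Y₃ at *
  generalize Y ^ 2 = Y₂ at *
  refine ⟨hS', ?_, ?_, ?_, ?_, ?_, ?_⟩ <;> omega

end RAM

/-! ### Approximation guarantee and total running time -/

namespace MEE

open RAM in
/-- The scheme, run on the encoding of an instance. -/
theorem Instance.scheme_exec (I : Instance) {n : ℕ} (hn : 0 < n) :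
    ∃ t M, Exec scheme (initMem (n :: I.encode)) t M ∧
      t ≤ 27000000 * scheme.weight * (wordSize I.encode + n) ^ 9 ∧
      ∃ S : tours I.r I.s, Describes (output M) S.1 ∧
        ∀ S' : tours I.r I.s, (n : ℚ) * I.objective S.1 ≤ (n + 1) * I.objective S'.1 := by
  set X := wordSize I.encode + n with hX
  have hX1 : 1 ≤ X := by omega
  have hsub : wordSize I.encode = (I.r.size + 1) + ((I.s.size + 1) + wordSize I.costWords) := by
    rw [I.encode_eq]
    simp [wordSize]
  -- The input lists 4(r + rs) words, so r itself, not merely its binary length, is bounded by the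
  -- input size.
  have hlen := length_le_wordSize I.costWords
  rw [I.length_costWords] at hlen
  have hrX : I.r ≤ X := by omega
  have hsX : I.s ≤ X := I.s_le_r.trans hrX
  have hD : I.multiple n ≤ 2 ^ X :=
    (I.multiple_le n).trans (Nat.pow_le_pow_right (by norm_num) (by omega))
  obtain ⟨b₁, b₂, b₃, b₄, b₅, b₆, b₇⟩ := scheme_bounds hX1 hrX hsX (show n ≤ X by omega) hD rfl
  have hr := I.three_le
  have hbd : Bounded (6 * X + 20) (initMem (n :: I.encode)) := by
    intro x i
    refine (bounded_initMem _ x i).trans_le (Nat.pow_le_pow_right (by norm_num) ?_)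
    have : wordSize (n :: I.encode) = n.size + 1 + wordSize I.encode := by simp [wordSize]
    have := size_le_self n
    omega
  obtain ⟨t, M, hexec, ht, -, o, ho, hout, hopt⟩ :=
    scheme_runs (M := initMem (n :: I.encode)) (D := I.multiple n) (L := 3 * X + 3)
      (show 0 < I.r by omega) hn (I.denPos_input n) rfl rfl b₁ b₂ b₃ b₄ b₅ b₆ b₇ hbd
  change t ≤ schemeSteps I.r I.s n (3 * X + 3) * (scheme.weight * (6 * X + 20 + 1)) at ht
  clear b₁ b₂ b₃ b₄ b₅ b₆ b₇
  refine ⟨t, M, hexec, ht.trans ?_, ?_⟩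
  · have hsteps := schemeSteps_le (r := I.r) (s := I.s) (n := n) (L := 3 * X + 3) hX1 hrX hsX
      (by omega) (by omega)
    have hb : 6 * X + 20 + 1 ≤ 27 * X := by omega
    generalize scheme.weight = κ
    calc schemeSteps I.r I.s n (3 * X + 3) * (κ * (6 * X + 20 + 1))
        ≤ 1000000 * X ^ 8 * (κ * (27 * X)) := by gcongr
      _ = 27000000 * κ * X ^ 9 := by ring
  · obtain ⟨π, hπ⟩ := exists_represents_of_isAssignment I.s_le_r ho
    refine ⟨⟨ejectInsert π, ejectInsert_mem_tours I.three_le π⟩, ?_, ?_⟩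
    · rw [hout]
      have := describes_ejectInsert I.three_le π
      rw [← hπ.tourList_eq ho] at this
      exact this
    · rintro ⟨τ, hτ, π', rfl⟩
      obtain ⟨σ, hσ, hπ'⟩ := exists_isAssignment_represents I.s_le_r π'
      have h₁ : n * (entryCost (I.input n) (I.multiple n) 0 o *
          entryCost (I.input n) (I.multiple n) 2 o) ≤
          (n + 1) * (entryCost (I.input n) (I.multiple n) 0 σ *
            entryCost (I.input n) (I.multiple n) 2 σ) := hopt σ hσ
      have h₂ : (n : ℚ) * ((entryCost (I.input n) (I.multiple n) 0 o *
          entryCost (I.input n) (I.multiple n) 2 o : ℕ) : ℚ) ≤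
          (n + 1) * ((entryCost (I.input n) (I.multiple n) 0 σ *
            entryCost (I.input n) (I.multiple n) 2 σ : ℕ) : ℚ) := by exact_mod_cast h₁
      rw [entryCost_mul_entryCost hπ ho, entryCost_mul_entryCost hπ' hσ] at h₂
      have hpos : (0 : ℚ) < (4 * I.multiple n) ^ 2 := by
        have : (0 : ℚ) < I.multiple n := by exact_mod_cast I.multiple_pos n
        exact pow_pos (mul_pos four_pos this) 2
      refine le_of_mul_le_mul_left ?_ hpos
      calc _ = (n : ℚ) * ((4 * I.multiple n) ^ 2 * I.objective (ejectInsert π)) := by ring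
        _ ≤ _ := h₂
        _ = _ := by ring

open RAM in
theorem Instance.scheme_fptas (I : Instance) {ε : ℝ} (hε : 0 < ε) :
    ∃ t M, Exec scheme (initMem (⌈1 / ε⌉₊ :: I.encode)) t M ∧
      (t : ℝ) ≤ (27000000 * scheme.weight * 2 ^ 9 : ℕ) *
        ((wordSize I.encode : ℝ) + 1 / ε) ^ 9 ∧
      ∃ S : tours I.r I.s, Describes (output M) S.1 ∧
        ∀ S' : tours I.r I.s, (I.objective S.1 : ℝ) ≤ (1 + ε) * (I.objective S'.1 : ℝ) := by
  have hε' : 0 < 1 / ε := by positivity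
  have hn : 0 < ⌈1 / ε⌉₊ := Nat.ceil_pos.2 hε'
  obtain ⟨t, M, hexec, ht, S, hS, hopt⟩ := I.scheme_exec hn
  refine ⟨t, M, hexec, ?_, S, hS, ?_⟩
  · have hone : (1 : ℝ) ≤ wordSize I.encode := by
      have h := length_le_wordSize I.encode
      rw [I.encode_eq, List.length_cons, ← I.encode_eq] at h
      exact_mod_cast (Nat.le_add_left 1 _).trans h
    have hceil : (⌈1 / ε⌉₊ : ℝ) ≤ 1 / ε + 1 := (Nat.ceil_lt_add_one hε'.le).le
    generalize scheme.weight = κ at ht ⊢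
    calc (t : ℝ) ≤ 27000000 * κ * ((wordSize I.encode : ℝ) + ⌈1 / ε⌉₊) ^ 9 := by
          exact_mod_cast ht
      _ ≤ 27000000 * κ * (2 * ((wordSize I.encode : ℝ) + 1 / ε)) ^ 9 := by
          gcongr
          linarith
      _ = _ := by
          push_cast
          ring
  · intro S'
    have h₁ : (⌈1 / ε⌉₊ : ℝ) * (I.objective S.1 : ℝ) ≤
        ((⌈1 / ε⌉₊ : ℝ) + 1) * (I.objective S'.1 : ℝ) := by
      exact_mod_cast hopt S'
    have h₂ : 1 / ε ≤ (⌈1 / ε⌉₊ : ℝ) := Nat.le_ceil _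
    have h₃ : (0 : ℝ) ≤ (I.objective S'.1 : ℝ) := by
      obtain ⟨τ, hτ, π, rfl⟩ := S'
      exact_mod_cast objective_nonneg π
    have hnpos : (0 : ℝ) < ⌈1 / ε⌉₊ := by exact_mod_cast hn
    -- Equivalently 1/n ≤ ε, so the guarantee 1 + 1/n is at least as strong as 1 + ε; objective
    -- values are nonnegative.
    have h₄ : (1 : ℝ) ≤ ε * ⌈1 / ε⌉₊ := by
      rw [div_le_iff₀ hε] at h₂
      linarith
    refine le_of_mul_le_mul_left ?_ hnpos
    calc (⌈1 / ε⌉₊ : ℝ) * (I.objective S.1 : ℝ)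
        ≤ ((⌈1 / ε⌉₊ : ℝ) + 1) * (I.objective S'.1 : ℝ) := h₁
      _ ≤ ((⌈1 / ε⌉₊ : ℝ) + ε * ⌈1 / ε⌉₊) * (I.objective S'.1 : ℝ) := by gcongr
      _ = _ := by ring

end MEE

theorem mainTheorem10 : qtspRankOneMEE.AdmitsFPTAS :=
  ⟨RAM.scheme, 27000000 * RAM.scheme.weight * 2 ^ 9, 9, fun I _ hε =>
    MEE.Instance.scheme_fptas I hε⟩
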